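/- A planar periodic framework $(G,\Gamma,p,\pi)$ consists of the following data. $G=(V,E)$ is an infinite, connected, simple graph with finite vertex degrees. $\Gamma\subset\mathrm{Aut}(G)$ is a free abelian group of rank two which fixes no vertex and no edge (non-identity elements) and has finite quotients $V/\Gamma$ and $E/\Gamma$. $p:V\to\mathbb{R}^2$ is a placement with $p(u)\neq p(v)$ for every edge $\{u,v\}$. $\pi$ is an injective homomorphism from $\Gamma$ to the translations of $\mathbb{R}^2$ whose image is a lattice of rank two, and $p(\gamma v)=\pi(\gamma)(p(v))$ for all $\gamma\in\Gamma$, $v\in V$. The framework is non-crossing if the closed segments $[p(u),p(v)]$ of any two distinct edges $\{u,v\}$ are disjoint except for the common endpoint when the edges are adjacent. Its faces are the connected components of the complement in $\mathbb{R}^2$ of the union of all vertices and edge segments. A periodic pointed pseudo-triangulation is a non-crossing planar periodic framework such that (i) every face is a pseudo-triangle, that is, its boundary is a simple closed (finite) polygon formed by a cycle of $G$, and exactly three of its internal angles are smaller than $\pi$; (ii) at every vertex $v$ the set of edge vectors $p(u)-p(v)$, $\{u,v\}\in E$, is pointed, that is, no linear combination of them with all coefficients strictly positive is zero. **Proposition.**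 Let $(G,\Gamma,p,\pi)$ be a periodic pointed pseudo-triangulation, let $n=|V/\Gamma|$ and $m=|E/\Gamma|$ be the numbers of vertex orbits and edge orbits, and let $n^*$ be the number of orbits of faces under $\Gamma$ (acting by the translations $\pi(\Gamma)$). Then $n$, $m$, $n^*$ are finite and $$m=2n=2n^*.$$ -/

import Mathlib

open Filter Topology MeasureTheory

noncomputable section

/-- The Euclidean plane. -/
abbrev Plane : Type := EuclideanSpace ℝ (Fin 2)

/-- A family of vectors (finite in all uses below) is pointed if no linear combination of them
with all coefficients strictly positive is zero. -/
def IsPointedSet (S : Set Plane) : Prop :=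
  ¬ ∃ c : Plane → ℝ, (∀ x ∈ S, 0 < c x) ∧ ∑ᶠ x ∈ S, c x • x = 0

/-- The interior angle of a region `U` at the point `x`: the total measure, in radians, of the
set of directions in which one enters `U` when leaving `x`. For the region bounded by a simple
polygon and a vertex `x` of it, this is the usual internal angle, a number in `(0, 2π)`. -/
def interiorAngle (U : Set Plane) (x : Plane) : ℝ :=
  (volume {θ : ℝ | θ ∈ Set.Ioc (-Real.pi) Real.pi ∧
    ∀ᶠ r : ℝ in 𝓝[>] 0, x + r • (!₂[Real.cos θ, Real.sin θ] : Plane) ∈ U}).toReal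

/-- A planar 2-periodic framework `(G, Γ, p, π)`. -/
structure PeriodicFramework (V : Type*) where
  /-- the graph `G` (simple, infinite, connected, with finite degrees) -/
  graph : SimpleGraph V
  infinite : Infinite V
  connected : graph.Connected
  finite_degree : ∀ v, (graph.neighborSet v).Finite
  /-- the periodicity group: automorphisms of `G`, free abelian of rank two -/
  Γ : Subgroup (graph ≃g graph)
  free_abelian : Nonempty (Γ ≃* Multiplicative (ℤ × ℤ))
  no_fixed_vertex : ∀ γ ∈ Γ, γ ≠ 1 → ∀ v, γ v ≠ v
  no_fixed_edge : ∀ γ ∈ Γ, γ ≠ 1 → ∀ e ∈ graph.edgeSet, Sym2.map γ e ≠ e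
  /-- the quotient multigraph `G/Γ` has finitely many vertices -/
  finite_vertices : ∃ T : Set V, T.Finite ∧ ∀ v, ∃ u ∈ T, ∃ γ ∈ Γ, γ u = v
  /-- the quotient multigraph `G/Γ` has finitely many edges -/
  finite_edges : ∃ T : Set (Sym2 V), T.Finite ∧
    ∀ e ∈ graph.edgeSet, ∃ f ∈ T, ∃ γ ∈ Γ, Sym2.map γ f = e
  /-- the placement -/
  p : V → Plane
  placement : ∀ u v, graph.Adj u v → p u ≠ p v
  /-- the representation of `Γ` by translations (identified with translation vectors) -/
  π : Additive Γ →+ Plane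
  π_injective : Function.Injective π
  /-- `π(Γ)` is a lattice of rank two -/
  lattice : ∃ b : Module.Basis (Fin 2) ℝ Plane,
    Set.range π = (Submodule.span ℤ (Set.range b) : Set Plane)
  periodic : ∀ (γ : Γ) (v : V), p ((γ : graph ≃g graph) v) = p v + π (Additive.ofMul γ)

namespace PeriodicFramework

variable {V : Type*} (F : PeriodicFramework V)

/-- The closed segment `[p u, p v]` of an edge `{u, v}`. -/
def edgeSegment : Sym2 V → Set Plane :=
  Sym2.lift ⟨fun u v => segment ℝ (F.p u) (F.p v), fun _ _ => segment_symm ℝ _ _⟩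

/-- The points of the plane covered by the framework. -/
def skeleton : Set Plane :=
  Set.range F.p ∪ ⋃ e ∈ F.graph.edgeSet, F.edgeSegment e

/-- Distinct edges have disjoint segments, except for a common endpoint. -/
def NonCrossing : Prop :=
  ∀ e ∈ F.graph.edgeSet, ∀ e' ∈ F.graph.edgeSet, e ≠ e' →
    F.edgeSegment e ∩ F.edgeSegment e' ⊆ F.p '' {v | v ∈ e ∧ v ∈ e'}

/-- The faces: connected components of the complement of the framework. -/
def faces : Set (Set Plane) :=
  {U | ∃ x ∈ F.skeletonᶜ, U = connectedComponentIn F.skeletonᶜ x}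

/-- The cycle `w` of the graph bounds `U`: the boundary of `U` is the closed polygon with the
cyclic sequence of vertices `w` (a simple polygon when the framework is non-crossing). -/
def IsBoundaryCycle (U : Set Plane) {v : V} (w : F.graph.Walk v v) : Prop :=
  w.IsCycle ∧ frontier U = ⋃ e ∈ w.edges, F.edgeSegment e

/-- The region `U` is a pseudo-triangle: it is bounded by a closed polygon with exactly three
internal angles smaller than `π`. -/
def IsPseudoTriangle (U : Set Plane) : Prop :=
  ∃ (v : V) (w : F.graph.Walk v v), F.IsBoundaryCycle U w ∧
    {u | u ∈ w.support ∧ interiorAngle U (F.p u) < Real.pi}.ncard = 3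

/-- The edge vectors at the vertex `v` form a pointed set. -/
def IsPointedAt (v : V) : Prop :=
  IsPointedSet {x | ∃ u, F.graph.Adj v u ∧ x = F.p u - F.p v}

/-- Periodic pointed pseudo-triangulations. -/
structure IsPointedPseudoTriangulation : Prop where
  nonCrossing : F.NonCrossing
  pseudoTriangle : ∀ U ∈ F.faces, F.IsPseudoTriangle U
  pointed : ∀ v, F.IsPointedAt v

/-- Two vertices are in the same `Γ`-orbit. -/
def vertexSetoid : Setoid V where
  r u v := ∃ γ ∈ F.Γ, γ u = v
  iseqv :=
    { refl := fun _ => ⟨1, F.Γ.one_mem, rfl⟩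
      symm := by
        rintro u _ ⟨γ, hγ, rfl⟩
        exact ⟨γ⁻¹, F.Γ.inv_mem hγ, γ.symm_apply_apply u⟩
      trans := by
        rintro u _ _ ⟨γ, hγ, rfl⟩ ⟨δ, hδ, rfl⟩
        exact ⟨δ * γ, F.Γ.mul_mem hδ hγ, rfl⟩ }

/-- Two edges are in the same `Γ`-orbit. -/
def edgeSetoid : Setoid F.graph.edgeSet where
  r e f := ∃ γ ∈ F.Γ, Sym2.map γ (e : Sym2 V) = f
  iseqv :=
    { refl := fun e => ⟨1, F.Γ.one_mem, by
        change Sym2.map id (e : Sym2 V) = e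
        simp⟩
      symm := by
        rintro ⟨e, he⟩ ⟨f, hf⟩ ⟨γ, hγ, h⟩
        refine ⟨γ⁻¹, F.Γ.inv_mem hγ, ?_⟩
        simp only at h ⊢
        rw [← h, Sym2.map_map]
        have : (⇑γ⁻¹ ∘ ⇑γ) = id := funext fun u => γ.symm_apply_apply u
        rw [this]
        simp
      trans := by
        rintro ⟨e, he⟩ ⟨f, hf⟩ ⟨g, hg⟩ ⟨γ, hγ, h⟩ ⟨δ, hδ, h'⟩
        refine ⟨δ * γ, F.Γ.mul_mem hδ hγ, ?_⟩
        simp only at h h' ⊢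
        rw [← h', ← h, Sym2.map_map]
        rfl }

/-- Two faces are in the same `Γ`-orbit: one is a translate of the other by a period. -/
def faceSetoid : Setoid F.faces where
  r U W := ∃ γ : F.Γ, (fun x => x + F.π (Additive.ofMul γ)) '' (U : Set Plane) = W
  iseqv :=
    { refl := fun U => ⟨1, by simp⟩
      symm := by
        rintro ⟨U, hU⟩ ⟨W, hW⟩ ⟨γ, h⟩
        refine ⟨γ⁻¹, ?_⟩
        simp only at h ⊢
        rw [← h, Set.image_image]
        simp
      trans := by
        rintro ⟨U, hU⟩ ⟨W, hW⟩ ⟨X, hX⟩ ⟨γ, h⟩ ⟨δ, h'⟩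
        refine ⟨γ * δ, ?_⟩
        simp only at h h' ⊢
        rw [← h', ← h, Set.image_image]
        simp [add_assoc] }

/-- The set `V/Γ` of vertex orbits. -/
abbrev VertexOrbits : Type _ := Quotient F.vertexSetoid

/-- The set `E/Γ` of edge orbits. -/
abbrev EdgeOrbits : Type _ := Quotient F.edgeSetoid

/-- The set of face orbits. -/
abbrev FaceOrbits : Type _ := Quotient F.faceSetoid

end PeriodicFramework

end

/-! The internal angles smaller than π are counted modulo periods in two ways, and the result is
combined with Euler's relation for the quotient torus.

At a vertex there are as many angles as edges (`ncard_facesAt`), and exactly one of them is at least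
π (`exists_large_angle`). Pointedness puts the edges in a closed half-plane, so a single face
contains the opposite open half-disc; every other face gets less than π, since some further set of
directions of positive measure belongs neither to it nor to that half-plane. The vertices thus
contribute the sum of (degree - 1), which is 2m - n, and the faces contribute 3n*. Hence 2m - n =
3n*.

Euler's relation m = n + n* (`card_edgeOrbits_eq`) is obtained without forming the quotient surface.
Finitely supported chains mod 2 of faces, edges and vertices are free modules of ranks n*, m, n over
the group ring of Γ, which is a domain because Γ is ℤ². The face boundary is injective
(`bdry₂_injective`), every cycle of edges bounds faces (`exists_bdry₂_eq`), and the zeroth homology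
is torsion because Γ acts trivially on it, so the alternating sum of ranks vanishes
(`card_orbits_of_exact`). Exactness at the edges is a Jordan curve theorem mod 2: the parity of
crossings of a horizontal ray with a cycle is constant on faces, jumps exactly across the edges of
the cycle, and vanishes far away.

The two relations give n = n* and m = 2n. -/

noncomputable section

/-! ### Permutation modules over a group ring and counting orbits -/

section OrbitRank

variable (k : Type*) [Field k] (A : Type*) [CommGroup A]

/-- The linear representation of `A` on finitely supported functions on an `A`-set. -/
def permRep (X : Type*) [MulAction A X] : Representation k A (X →₀ k) where
  toFun a := Finsupp.lmapDomain k k (a • ·)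
  map_one' := by ext; simp
  map_mul' a b := by ext; simp [mul_smul]

variable {k A}

theorem permRep_single {X : Type*} [MulAction A X] (a : A) (x : X) (t : k) :
    permRep k A X a (Finsupp.single x t) = Finsupp.single (a • x) t := by
  simp [permRep]

variable (k A) in
/-- The permutation module of an `A`-set, as a module over the group ring. -/
def PermModule (X : Type*) [MulAction A X] : Type _ := let _ := A; X →₀ k

instance (X : Type*) [MulAction A X] : AddCommGroup (PermModule k A X) :=
  inferInstanceAs (AddCommGroup (X →₀ k))

instance (X : Type*) [MulAction A X] : Module (MonoidAlgebra k A) (PermModule k A X) :=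
  letI : Module (Module.End k (X →₀ k)) (PermModule k A X) :=
    inferInstanceAs (Module (Module.End k (X →₀ k)) (X →₀ k))
  Module.compHom _ (permRep k A X).asAlgebraHom.toRingHom

variable (k A) in
/-- The permutation module consists of the finitely supported functions. -/
def PermModule.equiv (X : Type*) [MulAction A X] : PermModule k A X ≃+ (X →₀ k) :=
  AddEquiv.refl _

theorem PermModule.equiv_single_smul {X : Type*} [MulAction A X] (a : A) (t : k)
    (f : PermModule k A X) :
    PermModule.equiv k A X (MonoidAlgebra.single a t • f) =
      t • permRep k A X a (PermModule.equiv k A X f) := by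
  change (permRep k A X).asAlgebraHom (MonoidAlgebra.single a t) (PermModule.equiv k A X f) = _
  simp

variable (k A) in
/-- The element of the permutation module given by a point. -/
def permPt {X : Type*} [MulAction A X] (x : X) : PermModule k A X :=
  (PermModule.equiv k A X).symm (Finsupp.single x 1)

theorem PermModule.equiv_single_smul_permPt {X : Type*} [MulAction A X] (a : A) (t : k) (x : X) :
    PermModule.equiv k A X (MonoidAlgebra.single a t • permPt k A x) =
      Finsupp.single (a • x) t := by
  rw [PermModule.equiv_single_smul]
  simp [permPt, permRep_single]

-- By freeness a point of the orbit `q` is `a • out q` for a unique `a`, so each coefficient of the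
-- combination can be read off at one point. This is the linear independence of the orbit
-- representatives.
open scoped Classical in
theorem PermModule.equiv_linearCombination_apply {X : Type*} [MulAction A X]
    (free : ∀ (a : A) (x : X), a • x = x → a = 1)
    (l : MulAction.orbitRel.Quotient A X →₀ MonoidAlgebra k A)
    (a : A) (q : MulAction.orbitRel.Quotient A X) :
    PermModule.equiv k A X (Finsupp.linearCombination (MonoidAlgebra k A)
      (fun q => permPt k A (Quotient.out q : X)) l) (a • (Quotient.out q : X)) =
        (l q).coeff a := by
  induction l using Finsupp.induction_linear with
  | zero => simp
  | add f g hf hg => simp [hf, hg]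
  | single q' r =>
    rw [Finsupp.linearCombination_single]
    induction r using MonoidAlgebra.induction_linear with
    | zero => simp
    | add f g hf hg => simp [add_smul, hf, hg, Finsupp.single_add]
    | single b t =>
      rw [PermModule.equiv_single_smul_permPt]
      by_cases hq : q' = q
      · subst hq
        rw [Finsupp.single_eq_same, MonoidAlgebra.coeff_single]
        by_cases hab : b = a
        · subst hab; simp
        · rw [Finsupp.single_eq_of_ne, Finsupp.single_eq_of_ne]
          · exact fun h => hab h.symm
          · intro h
            apply hab
            have := free (b⁻¹ * a) (Quotient.out q') (by rw [mul_smul, h, inv_smul_smul])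
            rw [inv_mul_eq_one] at this
            exact this
      · rw [Finsupp.single_eq_of_ne, Finsupp.single_eq_of_ne (Ne.symm hq)]
        · simp
        · intro h
          apply hq
          rw [← Quotient.out_eq q, ← Quotient.out_eq q']
          refine Quotient.sound ?_
          change MulAction.orbitRel A X _ _
          rw [MulAction.orbitRel_apply, MulAction.mem_orbit_iff]
          exact ⟨b⁻¹ * a, by rw [mul_smul, h, inv_smul_smul]⟩

variable (k) in
/-- Orbit representatives form a basis of the permutation module of a free action. -/
def permBasis {X : Type*} [MulAction A X] (free : ∀ (a : A) (x : X), a • x = x → a = 1) :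
    Module.Basis (MulAction.orbitRel.Quotient A X) (MonoidAlgebra k A) (PermModule k A X) :=
  Module.Basis.mk (v := fun q => permPt k A (Quotient.out q : X))
    (by
      intro l l' hl
      ext q a
      rw [← PermModule.equiv_linearCombination_apply free, hl,
        PermModule.equiv_linearCombination_apply free])
    (by
      intro x _
      obtain ⟨f, rfl⟩ := (PermModule.equiv k A X).symm.surjective x
      induction f using Finsupp.induction_linear with
      | zero => simp
      | add f g hf hg =>
        rw [map_add]
        exact Submodule.add_mem _ (hf trivial) (hg trivial)
      | single x t =>
        have hx : MulAction.orbitRel A X x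
            (Quotient.out (Quotient.mk (MulAction.orbitRel A X) x)) :=
          Setoid.symm' _ (Quotient.mk_out (s := MulAction.orbitRel A X) x)
        rw [MulAction.orbitRel_apply, MulAction.mem_orbit_iff] at hx
        obtain ⟨a, ha⟩ := hx
        have : (PermModule.equiv k A X).symm (Finsupp.single x t) =
            MonoidAlgebra.single a t • permPt k A
              (Quotient.out (Quotient.mk (MulAction.orbitRel A X) x)) := by
          apply (PermModule.equiv k A X).injective
          rw [PermModule.equiv_single_smul_permPt, ha]
          simp
        rw [this]
        exact Submodule.smul_mem _ _ (Submodule.subset_span ⟨_, rfl⟩))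

/-- Equivariant linear maps between permutation modules are linear over the group ring. -/
def permMap {X Y : Type*} [MulAction A X] [MulAction A Y] (d : (Y →₀ k) →ₗ[k] (X →₀ k))
    (hd : ∀ a y, d (permRep k A Y a y) = permRep k A X a (d y)) :
    PermModule k A Y →ₗ[MonoidAlgebra k A] PermModule k A X where
  toFun y := (PermModule.equiv k A X).symm (d (PermModule.equiv k A Y y))
  map_add' := by simp
  map_smul' r y := by
    apply (PermModule.equiv k A X).injective
    induction r using MonoidAlgebra.induction_linear with
    | zero => simp
    | add f g hf hg => simpa [add_smul] using congrArg₂ (· + ·) hf hg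
    | single b t => simp [PermModule.equiv_single_smul, hd]

/-- The Euler relation for an exact complex of permutation modules of a free action whose
zeroth homology is trivial. -/
theorem card_orbits_of_exact [UniqueProds A] [Nontrivial A] {X Y Z : Type*}
    [MulAction A X] [MulAction A Y] [MulAction A Z]
    (freeX : ∀ (a : A) (x : X), a • x = x → a = 1)
    (freeY : ∀ (a : A) (x : Y), a • x = x → a = 1)
    (freeZ : ∀ (a : A) (x : Z), a • x = x → a = 1)
    [Finite (MulAction.orbitRel.Quotient A X)] [Finite (MulAction.orbitRel.Quotient A Y)]
    (d₁ : (Y →₀ k) →ₗ[k] (X →₀ k)) (d₂ : (Z →₀ k) →ₗ[k] (Y →₀ k))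
    (hd₁ : ∀ a y, d₁ (permRep k A Y a y) = permRep k A X a (d₁ y))
    (hd₂ : ∀ a z, d₂ (permRep k A Z a z) = permRep k A Y a (d₂ z))
    (inj : Function.Injective d₂) (exact : Function.Exact d₂ d₁)
    (coker : ∀ x x' : X, Finsupp.single x 1 - Finsupp.single x' 1 ∈ LinearMap.range d₁) :
    Nat.card (MulAction.orbitRel.Quotient A Y) =
      Nat.card (MulAction.orbitRel.Quotient A X) + Nat.card (MulAction.orbitRel.Quotient A Z) := by
  have : Module.Finite (MonoidAlgebra k A) (PermModule k A X) := .of_basis (permBasis k freeX)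
  have : Module.Finite (MonoidAlgebra k A) (PermModule k A Y) := .of_basis (permBasis k freeY)
  let D₁ := permMap d₁ hd₁
  let D₂ := permMap d₂ hd₂
  have hinj : Function.Injective D₂ :=
    (PermModule.equiv k A Y).symm.injective.comp (inj.comp (PermModule.equiv k A Z).injective)
  have hker : LinearMap.ker D₁ = LinearMap.range D₂ := by
    ext y
    have := exact (PermModule.equiv k A Y y)
    rw [LinearMap.mem_ker, LinearMap.mem_range]
    change (PermModule.equiv k A X).symm (d₁ (PermModule.equiv k A Y y)) = 0 ↔ _
    rw [EmbeddingLike.map_eq_zero_iff, this, Set.mem_range]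
    exact Iff.rfl
  -- By `coker` the group acts trivially on the zeroth homology, so a single nonzero ring element `a
  -- - 1` kills all of it.
  have htors : Module.finrank (MonoidAlgebra k A) (PermModule k A X ⧸ LinearMap.range D₁) = 0 := by
    obtain ⟨a, ha⟩ := exists_ne (1 : A)
    apply Module.IsTorsion.finrank_eq_zero
    intro x
    induction x using Submodule.Quotient.induction_on with | _ x =>
    have hr : (MonoidAlgebra.single a 1 - 1 : MonoidAlgebra k A) ≠ 0 := by
      intro h
      rw [sub_eq_zero, MonoidAlgebra.one_def] at h
      have := congrArg (fun f => MonoidAlgebra.coeff f a) h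
      simp [ha.symm] at this
    refine ⟨⟨_, mem_nonZeroDivisors_of_ne_zero hr⟩, ?_⟩
    change (MonoidAlgebra.single a 1 - 1 : MonoidAlgebra k A) •
      (Submodule.Quotient.mk x : PermModule k A X ⧸ LinearMap.range D₁) = 0
    rw [← Submodule.Quotient.mk_smul, Submodule.Quotient.mk_eq_zero]
    obtain ⟨f, rfl⟩ := (PermModule.equiv k A X).symm.surjective x
    have : ∀ f : X →₀ k, permRep k A X a f - f ∈ LinearMap.range d₁ := by
      intro f
      induction f using Finsupp.induction_linear with
      | zero => simp
      | add f g hf hg =>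
        rw [map_add, add_sub_add_comm]
        exact Submodule.add_mem _ hf hg
      | single x t =>
        rw [permRep_single]
        have := Submodule.smul_mem _ t (coker (a • x) x)
        simpa [smul_sub] using this
    obtain ⟨y, hy⟩ := this f
    refine ⟨(PermModule.equiv k A Y).symm y, ?_⟩
    apply (PermModule.equiv k A X).injective
    rw [sub_smul, one_smul, map_sub, PermModule.equiv_single_smul, one_smul]
    exact hy
  -- Rank-nullity holds because `UniqueProds` makes the group ring a domain; it is applied once at
  -- the edges and once at the vertices.
  have h1 := Submodule.finrank_quotient_add_finrank (LinearMap.ker D₁)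
  have h2 := Submodule.finrank_quotient_add_finrank (LinearMap.range D₁)
  rw [(LinearMap.quotKerEquivRange D₁).finrank_eq, hker,
    ← (LinearEquiv.ofInjective D₂ hinj).finrank_eq,
    Module.finrank_eq_nat_card_basis (permBasis k freeY),
    Module.finrank_eq_nat_card_basis (permBasis k freeZ)] at h1
  rw [htors, Module.finrank_eq_nat_card_basis (permBasis k freeX)] at h2
  omega

end OrbitRank

/-- Counting the orbits of the total space of an equivariant map to a free action by fibres. -/
theorem card_orbits_eq_sum_fibre {A X Y : Type*} [Group A] [MulAction A X] [MulAction A Y]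
    [Finite (MulAction.orbitRel.Quotient A Y)]
    (free : ∀ (a : A) (y : Y), a • y = y → a = 1)
    (f : X → Y) (hf : ∀ (a : A) x, f (a • x) = a • f x)
    (fin : ∀ y, Finite {x // f x = y}) :
    Nat.card (MulAction.orbitRel.Quotient A X) =
      ∑ᶠ q : MulAction.orbitRel.Quotient A Y, Nat.card {x // f x = Quotient.out q} := by
  have := Fintype.ofFinite (MulAction.orbitRel.Quotient A Y)
  rw [finsum_eq_sum_of_fintype, ← Nat.card_sigma]
  symm
  refine Nat.card_congr (Equiv.ofBijective
    (fun s => Quotient.mk (MulAction.orbitRel A X) s.2.1) ⟨?_, ?_⟩)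
  · rintro ⟨q, x, hx⟩ ⟨q', x', hx'⟩ h
    have h' : MulAction.orbitRel A X x x' := Quotient.exact h
    rw [MulAction.orbitRel_apply, MulAction.mem_orbit_iff] at h'
    obtain ⟨a, rfl⟩ := h'
    have hq : q = q' := by
      rw [← Quotient.out_eq q, ← Quotient.out_eq q']
      refine Quotient.sound ?_
      change MulAction.orbitRel A Y _ _
      rw [MulAction.orbitRel_apply, MulAction.mem_orbit_iff]
      exact ⟨a, by rw [← hx, ← hx', hf]⟩
    subst hq
    have : a = 1 := free a (f x') (by rw [← hf, hx, hx'])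
    subst this
    simp
  · intro q
    induction q using Quotient.inductionOn with | _ x =>
    have hx : MulAction.orbitRel A Y
        (Quotient.out (Quotient.mk (MulAction.orbitRel A Y) (f x))) (f x) :=
      Quotient.mk_out (s := MulAction.orbitRel A Y) (f x)
    rw [MulAction.orbitRel_apply, MulAction.mem_orbit_iff] at hx
    obtain ⟨a, ha⟩ := hx
    refine ⟨⟨Quotient.mk _ (f x), a • x, by rw [hf, ha]⟩, ?_⟩
    refine Quotient.sound ?_
    change MulAction.orbitRel A X _ _
    rw [MulAction.orbitRel_apply, MulAction.mem_orbit_iff]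
    exact ⟨a, rfl⟩

/-- Double counting of the orbits of an invariant relation between two free actions. -/
theorem sum_ncard_fibre_eq {A X Y : Type*} [Group A] [MulAction A X] [MulAction A Y]
    [Finite (MulAction.orbitRel.Quotient A X)] [Finite (MulAction.orbitRel.Quotient A Y)]
    (freeX : ∀ (a : A) (x : X), a • x = x → a = 1) (freeY : ∀ (a : A) (y : Y), a • y = y → a = 1)
    (S : SubMulAction A (X × Y)) (fin : ∀ x, {y | (x, y) ∈ S}.Finite) {c : ℕ} (hc : c ≠ 0)
    (card : ∀ y, {x | (x, y) ∈ S}.ncard = c) :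
    ∑ᶠ q : MulAction.orbitRel.Quotient A X, {y | ((Quotient.out q : X), y) ∈ S}.ncard =
      c * Nat.card (MulAction.orbitRel.Quotient A Y) := by
  have e₁ : ∀ x, Nonempty ({y | (x, y) ∈ S} ≃ {s : S // (s : X × Y).1 = x}) := fun x =>
    ⟨{toFun := fun y => ⟨⟨(x, y), y.2⟩, rfl⟩
      invFun := fun s => ⟨(s : X × Y).2, by
        obtain ⟨⟨⟨x', y⟩, hs⟩, rfl⟩ := s
        exact hs⟩
      left_inv := fun _ => rfl
      right_inv := by
        rintro ⟨⟨⟨x', y⟩, hs⟩, rfl⟩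
        rfl }⟩
  have e₂ : ∀ y, Nonempty ({x | (x, y) ∈ S} ≃ {s : S // (s : X × Y).2 = y}) := fun y =>
    ⟨{toFun := fun x => ⟨⟨(x, y), x.2⟩, rfl⟩
      invFun := fun s => ⟨(s : X × Y).1, by
        obtain ⟨⟨⟨x, y'⟩, hs⟩, rfl⟩ := s
        exact hs⟩
      left_inv := fun _ => rfl
      right_inv := by
        rintro ⟨⟨⟨x, y'⟩, hs⟩, rfl⟩
        rfl }⟩
  -- The orbits of `S` itself are counted through both projections.
  have h₁ := card_orbits_eq_sum_fibre freeX (fun s : S => (s : X × Y).1) (fun _ _ => rfl)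
    fun x => have := (fin x).to_subtype; Finite.of_equiv _ (e₁ x).some
  -- As `ncard` is zero on infinite sets, `c ≠ 0` is what makes these fibres finite.
  have h₂ := card_orbits_eq_sum_fibre freeY (fun s : S => (s : X × Y).2) (fun _ _ => rfl)
    fun y => have := (Set.finite_of_ncard_ne_zero ((card y).trans_ne hc)).to_subtype
      Finite.of_equiv _ (e₂ y).some
  have c₁ : ∀ x, Nat.card {s : S // (s : X × Y).1 = x} = {y | (x, y) ∈ S}.ncard := fun x => by
    rw [← Nat.card_congr (e₁ x).some, Nat.card_coe_set_eq]
  have c₂ : ∀ y, Nat.card {s : S // (s : X × Y).2 = y} = c := fun y => by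
    rw [← Nat.card_congr (e₂ y).some, Nat.card_coe_set_eq, card]
  simp only [c₁] at h₁
  simp only [c₂] at h₂
  rw [← h₁, h₂]
  have := Fintype.ofFinite (MulAction.orbitRel.Quotient A Y)
  rw [finsum_eq_sum_of_fintype, Finset.sum_const, smul_eq_mul, mul_comm, Finset.card_univ,
    Nat.card_eq_fintype_card]

/-! ### The crossing parity of a segment -/

/-- The orientation of the triangle `a, b, x` (twice its signed area). -/
def crossTerm (a b x : Plane) : ℝ := (x 1 - a 1) * (b 0 - a 0) - (x 0 - a 0) * (b 1 - a 1)

open scoped Classical in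
/-- The indicator of `x` being at least as high as `a`. -/
def aboveInd (a x : Plane) : ZMod 2 := if a 1 ≤ x 1 then 1 else 0

open scoped Classical in
/-- The indicator of `a` being to the right of `q`. -/
def rightInd (q a : Plane) : ZMod 2 := if q 0 < a 0 then 1 else 0

open scoped Classical in
/-- The parity of the number of crossings of the rightward ray from `x` with the segment `[a, b]`,
where the lower endpoint counts as part of the segment and the upper one does not. -/
def crossInd (a b x : Plane) : ZMod 2 :=
  if 0 < crossTerm a b x * (b 1 - a 1) then aboveInd a x + aboveInd b x else 0

theorem crossTerm_swap (a b x : Plane) : crossTerm b a x = -crossTerm a b x := by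
  unfold crossTerm; ring

theorem crossInd_comm (a b x : Plane) : crossInd a b x = crossInd b a x := by
  unfold crossInd
  rw [crossTerm_swap a b x, add_comm]
  congr 2
  ring

theorem continuous_crossTerm (a b : Plane) : Continuous (crossTerm a b) := by
  unfold crossTerm; fun_prop

theorem mem_segment_iff_coord {a b x : Plane} :
    x ∈ segment ℝ a b ↔ ∃ t : ℝ, 0 ≤ t ∧ t ≤ 1 ∧
      x 0 = a 0 + t * (b 0 - a 0) ∧ x 1 = a 1 + t * (b 1 - a 1) := by
  rw [segment_eq_image']
  constructor
  · rintro ⟨t, ⟨h0, h1⟩, rfl⟩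
    exact ⟨t, h0, h1, by simp, by simp⟩
  · rintro ⟨t, h0, h1, hx, hy⟩
    refine ⟨t, ⟨h0, h1⟩, ?_⟩
    ext i
    fin_cases i
    · simpa using hx.symm
    · simpa using hy.symm

theorem mem_openSegment_iff_coord {a b x : Plane} :
    x ∈ openSegment ℝ a b ↔ ∃ t : ℝ, 0 < t ∧ t < 1 ∧
      x 0 = a 0 + t * (b 0 - a 0) ∧ x 1 = a 1 + t * (b 1 - a 1) := by
  rw [openSegment_eq_image']
  constructor
  · rintro ⟨t, ⟨h0, h1⟩, rfl⟩
    exact ⟨t, h0, h1, by simp, by simp⟩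
  · rintro ⟨t, h0, h1, hx, hy⟩
    refine ⟨t, ⟨h0, h1⟩, ?_⟩
    ext i
    fin_cases i
    · simpa using hx.symm
    · simpa using hy.symm

theorem eventually_aboveInd_eq {a q : Plane} (h : a 1 ≠ q 1) :
    ∀ᶠ x in 𝓝 q, aboveInd a x = aboveInd a q := by
  have hc : Continuous fun x : Plane => x 1 := by fun_prop
  rcases h.lt_or_gt with h | h
  · filter_upwards [hc.continuousAt.eventually (lt_mem_nhds h)] with x hx
    simp [aboveInd, hx.le, h.le]
  · filter_upwards [hc.continuousAt.eventually (gt_mem_nhds h)] with x hx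
    simp [aboveInd, not_le.2 hx, not_le.2 h]

/-- If `q` lies in the closed height range of the segment, it is strictly on one side of the line,
so the side condition is a constant `G` near `q`. The indicator of an endpoint can jump only if that
endpoint is at the height of `q`, and then `G` is exactly its `rightInd`; otherwise the indicator
goes into the constant. Outside the height range both indicators are constant and agree. -/
theorem crossInd_locally_of_lt {a b q : Plane} (hab : a 1 < b 1) (hq : q ∉ segment ℝ a b) :
    ∃ c, ∀ᶠ x in 𝓝 q, crossInd a b x =
      rightInd q a * aboveInd a x + rightInd q b * aboveInd b x + c := by
  by_cases hin : a 1 ≤ q 1 ∧ q 1 ≤ b 1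
  · obtain ⟨h1, h2⟩ := hin
    have hg : crossTerm a b q ≠ 0 := by
      intro h0
      apply hq
      rw [mem_segment_iff_coord]
      have hpos : 0 < b 1 - a 1 := by linarith
      refine ⟨(q 1 - a 1) / (b 1 - a 1), div_nonneg (by linarith) hpos.le,
        (div_le_one hpos).2 (by linarith), ?_, ?_⟩
      · unfold crossTerm at h0
        field_simp
        linarith
      · field_simp
        ring
    have hG : ∃ G : ZMod 2, (∀ᶠ x in 𝓝 q, crossInd a b x = G * (aboveInd a x + aboveInd b x)) ∧
        (G = if 0 < crossTerm a b q then 1 else 0) := by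
      rcases hg.lt_or_gt with h | h
      · refine ⟨0, ?_, by simp [not_lt.2 h.le]⟩
        filter_upwards [(continuous_crossTerm a b).continuousAt.eventually (gt_mem_nhds h)] with x hx
        rw [crossInd, if_neg]
        · simp
        · have := mul_pos (neg_pos.2 hx) (sub_pos.2 hab)
          linarith
      · refine ⟨1, ?_, by simp [h]⟩
        filter_upwards [(continuous_crossTerm a b).continuousAt.eventually (lt_mem_nhds h)] with x hx
        rw [crossInd, if_pos (mul_pos hx (sub_pos.2 hab)), one_mul]
    obtain ⟨G, hG, hGq⟩ := hG
    have ha : ∃ c, ∀ᶠ x in 𝓝 q, G * aboveInd a x = rightInd q a * aboveInd a x + c := by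
      by_cases h : a 1 = q 1
      · refine ⟨0, .of_forall fun x => ?_⟩
        have : G = rightInd q a := by
          rw [hGq, rightInd]
          congr 1
          have : crossTerm a b q = (a 0 - q 0) * (b 1 - a 1) := by
            unfold crossTerm; rw [h]; ring
          rw [this, mul_pos_iff_of_pos_right (sub_pos.2 hab), sub_pos]
        rw [this, add_zero]
      · refine ⟨G * aboveInd a q - rightInd q a * aboveInd a q, ?_⟩
        filter_upwards [eventually_aboveInd_eq h] with x hx
        rw [hx]; ring
    have hb : ∃ c, ∀ᶠ x in 𝓝 q, G * aboveInd b x = rightInd q b * aboveInd b x + c := by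
      by_cases h : b 1 = q 1
      · refine ⟨0, .of_forall fun x => ?_⟩
        have : G = rightInd q b := by
          rw [hGq, rightInd]
          congr 1
          have : crossTerm a b q = (b 0 - q 0) * (b 1 - a 1) := by
            unfold crossTerm; rw [← h]; ring
          rw [this, mul_pos_iff_of_pos_right (sub_pos.2 hab), sub_pos]
        rw [this, add_zero]
      · refine ⟨G * aboveInd b q - rightInd q b * aboveInd b q, ?_⟩
        filter_upwards [eventually_aboveInd_eq h] with x hx
        rw [hx]; ring
    obtain ⟨c, hc⟩ := ha
    obtain ⟨c', hc'⟩ := hb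
    refine ⟨c + c', ?_⟩
    filter_upwards [hG, hc, hc'] with x h h1 h2
    rw [h, mul_add, h1, h2]; ring
  · have hne : a 1 ≠ q 1 ∧ b 1 ≠ q 1 := by
      constructor <;> intro h <;> apply hin <;> constructor <;> linarith
    have heq : aboveInd a q = aboveInd b q := by
      unfold aboveInd
      congr 1
      rw [eq_iff_iff]
      constructor
      · intro h
        by_contra h'
        exact hin ⟨h, (not_le.1 h').le⟩
      · intro h
        linarith
    refine ⟨-(rightInd q a * aboveInd a q + rightInd q b * aboveInd b q), ?_⟩
    filter_upwards [eventually_aboveInd_eq hne.1, eventually_aboveInd_eq hne.2] with x h1 h2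
    rw [crossInd, h1, h2, heq, CharTwo.add_self_eq_zero, ite_self]
    ring

/-- Away from the segment, the crossing parity is locally constant up to terms that depend on a
single endpoint. -/
theorem crossInd_locally {a b q : Plane} (hq : q ∉ segment ℝ a b) :
    ∃ c, ∀ᶠ x in 𝓝 q, crossInd a b x =
      rightInd q a * aboveInd a x + rightInd q b * aboveInd b x + c := by
  rcases lt_trichotomy (a 1) (b 1) with h | h | h
  · exact crossInd_locally_of_lt h hq
  -- A horizontal segment never counts as crossed. At the height of `q` both endpoints lie on the
  -- same side of `q`, so their equal terms cancel mod 2.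
  · have hind : ∀ x, aboveInd a x = aboveInd b x := fun x => by simp [aboveInd, h]
    have h0 : ∀ x, crossInd a b x = 0 := fun x => by simp [crossInd, h]
    by_cases hqa : a 1 = q 1
    · refine ⟨0, .of_forall fun x => ?_⟩
      have : rightInd q a = rightInd q b := by
        unfold rightInd
        congr 1
        rw [eq_iff_iff]
        have key : ∀ a b : Plane, a 1 = b 1 → a 1 = q 1 → q ∉ segment ℝ a b →
            q 0 < a 0 → q 0 < b 0 := by
          intro a b h hqa hq h1
          by_contra h2
          apply hq
          rw [mem_segment_iff_coord]
          have hpos : 0 < a 0 - b 0 := by linarith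
          refine ⟨(a 0 - q 0) / (a 0 - b 0), div_nonneg (by linarith) hpos.le,
            (div_le_one hpos).2 (by linarith), ?_, ?_⟩
          · field_simp; ring
          · rw [← h, hqa]; ring
        exact ⟨key a b h hqa hq, key b a h.symm (h ▸ hqa) (by rwa [segment_symm])⟩
      rw [h0, hind, this, CharTwo.add_self_eq_zero, add_zero]
    · refine ⟨-(rightInd q a * aboveInd b q + rightInd q b * aboveInd b q), ?_⟩
      filter_upwards [eventually_aboveInd_eq (a := b) (by rwa [← h])] with x hx
      rw [h0, hind, hx]; ring
  · obtain ⟨c, hc⟩ := crossInd_locally_of_lt h (q := q) (by rwa [segment_symm])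
    refine ⟨c, ?_⟩
    filter_upwards [hc] with x hx
    rw [crossInd_comm, hx]; ring

/-- The height of `q` is strictly between those of the endpoints, so near `q` the indicators are 1
and 0 and only the sign of `crossTerm` matters. -/
theorem crossInd_jump_of_lt {a b q : Plane} (hab : a 1 < b 1) (hq : q ∈ openSegment ℝ a b) :
    ∃ c, ∀ᶠ x in 𝓝 q,
      (0 < crossTerm a b x → crossInd a b x =
        rightInd q a * aboveInd a x + rightInd q b * aboveInd b x + c) ∧
      (crossTerm a b x < 0 → crossInd a b x =
        rightInd q a * aboveInd a x + rightInd q b * aboveInd b x + c + 1) := by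
  rw [mem_openSegment_iff_coord] at hq
  obtain ⟨t, h0, h1, -, hy⟩ := hq
  have hpos : 0 < b 1 - a 1 := by linarith
  have ha : a 1 < q 1 := by nlinarith
  have hb : q 1 < b 1 := by nlinarith
  have hia : aboveInd a q = 1 := by simp [aboveInd, ha.le]
  have hib : aboveInd b q = 0 := by simp [aboveInd, hb]
  refine ⟨1 - rightInd q a, ?_⟩
  filter_upwards [eventually_aboveInd_eq ha.ne, eventually_aboveInd_eq hb.ne'] with x hxa hxb
  rw [crossInd, hxa, hxb, hia, hib]
  constructor
  · intro h
    rw [if_pos (mul_pos h hpos)]; ring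
  · intro h
    rw [if_neg (by nlinarith)]
    ring_nf
    exact (CharTwo.two_eq_zero).symm

/-- The crossing parity changes when the segment is crossed. -/
theorem crossInd_jump {a b q : Plane} (hab : a ≠ b) (hq : q ∈ openSegment ℝ a b) :
    ∃ c, ∀ᶠ x in 𝓝 q,
      (0 < crossTerm a b x → crossInd a b x =
        rightInd q a * aboveInd a x + rightInd q b * aboveInd b x + c) ∧
      (crossTerm a b x < 0 → crossInd a b x =
        rightInd q a * aboveInd a x + rightInd q b * aboveInd b x + c + 1) := by
  rcases lt_trichotomy (a 1) (b 1) with h | h | h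
  · exact crossInd_jump_of_lt h hq
  -- For a horizontal segment the jump comes from the endpoint terms alone: exactly one endpoint is
  -- to the right of `q`, and its height indicator changes across the line.
  · have hind : ∀ x, aboveInd b x = aboveInd a x := fun x => by simp [aboveInd, h]
    have h0 : ∀ x, crossInd a b x = 0 := fun x => by simp [crossInd, h]
    have hx0 : a 0 ≠ b 0 := by
      intro h'
      apply hab
      ext i
      fin_cases i
      · exact h'
      · exact h
    have hg : ∀ x, crossTerm a b x = (x 1 - a 1) * (b 0 - a 0) := fun x => by
      simp [crossTerm, h]
    rw [mem_openSegment_iff_coord] at hq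
    obtain ⟨t, ht0, ht1, hx, -⟩ := hq
    rcases hx0.lt_or_gt with h' | h'
    · have ra : rightInd q a = 0 := by
        rw [rightInd, if_neg]; nlinarith
      have rb : rightInd q b = 1 := by
        rw [rightInd, if_pos]; nlinarith
      refine ⟨1, .of_forall fun x => ⟨fun hx => ?_, fun hx => ?_⟩⟩ <;>
        rw [hg] at hx <;> rw [h0, hind, ra, rb, aboveInd]
      · rw [if_pos (by nlinarith)]; decide
      · rw [if_neg (by nlinarith)]; decide
    · have ra : rightInd q a = 1 := by
        rw [rightInd, if_pos]; nlinarith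
      have rb : rightInd q b = 0 := by
        rw [rightInd, if_neg]; nlinarith
      refine ⟨0, .of_forall fun x => ⟨fun hx => ?_, fun hx => ?_⟩⟩ <;>
        rw [hg] at hx <;> rw [h0, hind, ra, rb, aboveInd]
      · rw [if_neg (by nlinarith)]; decide
      · rw [if_pos (by nlinarith)]; decide
  · obtain ⟨c, hc⟩ := crossInd_jump_of_lt h (q := q) (by rwa [openSegment_symm])
    -- Exchanging the endpoints exchanges the two sides, which shifts the constant by one.
    refine ⟨c + 1, ?_⟩
    filter_upwards [hc] with x hx
    rw [crossTerm_swap a b] at hx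
    constructor
    · intro h
      rw [crossInd_comm, hx.2 (by linarith)]; ring
    · intro h
      rw [crossInd_comm, hx.1 (by linarith)]
      have : (1 : ZMod 2) + 1 = 0 := by decide
      linear_combination -this

/-- Far away, the crossing parity is a sum of endpoint terms with a common coefficient. -/
theorem crossInd_far {R : ℝ} {x : Plane} (hx : 2 * R < ‖x‖) :
    ∃ s : ZMod 2, ∀ a b : Plane, ‖a‖ ≤ R → ‖b‖ ≤ R →
      crossInd a b x = s * aboveInd a x + s * aboveInd b x := by
  by_cases hR : 0 ≤ R
  swap
  · exact ⟨0, fun a b ha => absurd ((norm_nonneg a).trans ha) hR⟩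
  have hco : ∀ (a : Plane) (i : Fin 2), ‖a‖ ≤ R → -R ≤ a i ∧ a i ≤ R := by
    intro a i ha
    have := (PiLp.norm_apply_le a i).trans ha
    rwa [Real.norm_eq_abs, abs_le] at this
  -- Above, below or to the right of the box of half-width `R` the ray misses every segment, so `s =
  -- 0`. To the left it meets a segment exactly when the endpoints are separated in height, so `s =
  -- 1`.
  by_cases h1 : R < x 1 ∨ x 1 < -R ∨ R < x 0
  · refine ⟨0, fun a b ha hb => ?_⟩
    have a0 := hco a 0 ha
    have a1 := hco a 1 ha
    have b0 := hco b 0 hb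
    have b1 := hco b 1 hb
    rw [zero_mul, zero_mul, add_zero, crossInd]
    split_ifs with hg
    · rcases h1 with h | h | h
      · simp only [aboveInd]
        rw [if_pos (by linarith), if_pos (by linarith)]; decide
      · simp only [aboveInd]
        rw [if_neg (by linarith), if_neg (by linarith)]; decide
      · simp only [aboveInd]
        unfold crossTerm at hg
        split_ifs with h2 h3 h3
        · decide
        · exfalso
          have e : ((x 1 - a 1) * (b 0 - a 0) - (x 0 - a 0) * (b 1 - a 1)) =
            -((x 1 - a 1) * (x 0 - b 0) + (x 0 - a 0) * (b 1 - x 1)) := by ring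
          rw [e] at hg
          have : 0 ≤ (x 1 - a 1) * (x 0 - b 0) + (x 0 - a 0) * (b 1 - x 1) :=
            add_nonneg (mul_nonneg (by linarith) (by linarith))
              (mul_nonneg (by linarith) (by linarith))
          nlinarith
        · exfalso
          have e : ((x 1 - a 1) * (b 0 - a 0) - (x 0 - a 0) * (b 1 - a 1)) =
            (a 1 - x 1) * (x 0 - b 0) + (x 0 - a 0) * (x 1 - b 1) := by ring
          rw [e] at hg
          have : 0 ≤ (a 1 - x 1) * (x 0 - b 0) + (x 0 - a 0) * (x 1 - b 1) :=
            add_nonneg (mul_nonneg (by linarith) (by linarith))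
              (mul_nonneg (by linarith) (by linarith))
          nlinarith
        · decide
    · rfl
  -- Otherwise `x` would lie in the box and have norm at most √2 `R`, less than the assumed bound
  -- 2`R` allows.
  · have hx0 : x 0 < -R := by
      by_contra hx0
      push Not at h1 hx0
      have hn : ‖x‖ ^ 2 = x 0 ^ 2 + x 1 ^ 2 := by
        rw [EuclideanSpace.norm_sq_eq, Fin.sum_univ_two]; simp
      have h0 : x 0 ^ 2 ≤ R ^ 2 := by nlinarith
      have h1' : x 1 ^ 2 ≤ R ^ 2 := by nlinarith
      nlinarith
    refine ⟨1, fun a b ha hb => ?_⟩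
    have a0 := hco a 0 ha
    have b0 := hco b 0 hb
    rw [one_mul, one_mul, crossInd]
    split_ifs with hg
    · rfl
    · simp only [aboveInd]
      unfold crossTerm at hg
      split_ifs with h2 h3 h3
      · decide
      · exfalso
        apply hg
        have e : ((x 1 - a 1) * (b 0 - a 0) - (x 0 - a 0) * (b 1 - a 1)) =
          (x 1 - a 1) * (b 0 - x 0) + (a 0 - x 0) * (b 1 - x 1) := by ring
        rw [e]
        have : 0 < (x 1 - a 1) * (b 0 - x 0) + (a 0 - x 0) * (b 1 - x 1) :=
          add_pos_of_nonneg_of_pos (mul_nonneg (by linarith) (by linarith))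
            (mul_pos (by linarith) (by linarith))
        exact mul_pos this (by linarith)
      · exfalso
        apply hg
        have e : ((x 1 - a 1) * (b 0 - a 0) - (x 0 - a 0) * (b 1 - a 1)) =
          -((a 1 - x 1) * (b 0 - x 0) + (a 0 - x 0) * (x 1 - b 1)) := by ring
        rw [e]
        have : 0 < (a 1 - x 1) * (b 0 - x 0) + (a 0 - x 0) * (x 1 - b 1) :=
          add_pos_of_pos_of_nonneg (mul_pos (by linarith) (by linarith))
            (mul_nonneg (by linarith) (by linarith))
        exact mul_pos_of_neg_of_neg (by linarith) (by linarith)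
      · decide

namespace PeriodicFramework

variable {V : Type*} (F : PeriodicFramework V)

/-! ### Local finiteness of periodic frameworks -/

@[simp]
theorem edgeSegment_mk (u v : V) : F.edgeSegment s(u, v) = segment ℝ (F.p u) (F.p v) := rfl

theorem exists_adj (v : V) : ∃ u, F.graph.Adj v u := by
  have := F.infinite
  exact F.connected.preconnected.exists_adj_of_nontrivial v

theorem p_mem_edgeSegment {v : V} {e : Sym2 V} (h : v ∈ e) : F.p v ∈ F.edgeSegment e := by
  induction e using Sym2.ind with | _ a b =>
  rcases Sym2.mem_iff.1 h with rfl | rfl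
  · exact left_mem_segment ..
  · exact right_mem_segment ..

theorem edgeSegment_subset_skeleton {e : Sym2 V} (he : e ∈ F.graph.edgeSet) :
    F.edgeSegment e ⊆ F.skeleton := fun _ hx => Or.inr (Set.mem_biUnion he hx)

theorem p_mem_skeleton (v : V) : F.p v ∈ F.skeleton := Or.inl ⟨v, rfl⟩

theorem mem_skeleton_iff {x : Plane} :
    x ∈ F.skeleton ↔ ∃ e ∈ F.graph.edgeSet, x ∈ F.edgeSegment e := by
  constructor
  · rintro (⟨v, rfl⟩ | h)
    · obtain ⟨u, hu⟩ := F.exists_adj v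
      exact ⟨s(v, u), hu, F.p_mem_edgeSegment (Sym2.mem_mk_left v u)⟩
    · simpa using h
  · rintro ⟨e, he, hx⟩
    exact F.edgeSegment_subset_skeleton he hx

theorem mem_edgeSegment_map {γ : F.graph ≃g F.graph} (hγ : γ ∈ F.Γ) (e : Sym2 V) (x : Plane) :
    x + F.π (Additive.ofMul ⟨γ, hγ⟩) ∈ F.edgeSegment (Sym2.map γ e) ↔ x ∈ F.edgeSegment e := by
  induction e using Sym2.ind with | _ a b =>
  have h := fun v => F.periodic ⟨γ, hγ⟩ v
  simp only at h
  rw [Sym2.map_mk, edgeSegment_mk, edgeSegment_mk, h, h, add_comm x, add_comm (F.p a),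
    add_comm (F.p b), mem_segment_translate]

theorem map_mem_edgeSet (γ : F.graph ≃g F.graph) {e : Sym2 V} :
    Sym2.map γ e ∈ F.graph.edgeSet ↔ e ∈ F.graph.edgeSet := by
  induction e using Sym2.ind with | _ a b =>
  exact γ.map_adj_iff

theorem mem_skeleton_translate (γ : F.Γ) (x : Plane) :
    x + F.π (Additive.ofMul γ) ∈ F.skeleton ↔ x ∈ F.skeleton := by
  have key : ∀ (γ : F.Γ) (x : Plane), x ∈ F.skeleton →
      x + F.π (Additive.ofMul γ) ∈ F.skeleton := by
    intro γ x hx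
    rw [mem_skeleton_iff] at hx ⊢
    obtain ⟨e, he, hx⟩ := hx
    exact ⟨Sym2.map γ e, (F.map_mem_edgeSet _).2 he, (F.mem_edgeSegment_map γ.2 e x).2 hx⟩
  refine ⟨fun h => ?_, key γ x⟩
  have := key γ⁻¹ _ h
  simpa using this

theorem finite_periods (R : ℝ) : {γ : F.Γ | ‖F.π (Additive.ofMul γ)‖ ≤ R}.Finite := by
  obtain ⟨b, hb⟩ := F.lattice
  have h := ZSpan.setFinite_inter b (s := Metric.closedBall 0 R) Metric.isBounded_closedBall
  refine Set.Finite.of_finite_image (f := fun γ => F.π (Additive.ofMul γ)) (h.subset ?_) ?_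
  · rintro _ ⟨γ, hγ, rfl⟩
    refine ⟨by simpa using hγ, ?_⟩
    rw [← hb]
    exact ⟨_, rfl⟩
  · intro γ _ γ' _ h
    exact F.π_injective h

theorem isCompact_edgeSegment (e : Sym2 V) : IsCompact (F.edgeSegment e) := by
  induction e using Sym2.ind with | _ a b =>
  rw [edgeSegment_mk, segment_eq_image]
  exact isCompact_Icc.image (by fun_prop)

/-- Every edge is a translate of one of finitely many bounded segments, so meeting `B` bounds the
translation vector, and a lattice has finitely many vectors of bounded length. -/
theorem finite_edges_meeting {B : Set Plane} (hB : Bornology.IsBounded B) :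
    {e ∈ F.graph.edgeSet | (F.edgeSegment e ∩ B).Nonempty}.Finite := by
  obtain ⟨T, hT, hTe⟩ := F.finite_edges
  obtain ⟨R, hR⟩ := hB.exists_norm_le
  have hbd : ∀ f : Sym2 V, ∃ r, ∀ x ∈ F.edgeSegment f, ‖x‖ ≤ r :=
    fun f => (F.isCompact_edgeSegment f).isBounded.exists_norm_le
  choose r hr using hbd
  refine (hT.biUnion fun f _ => (F.finite_periods (R + r f)).image
    fun γ : F.Γ => Sym2.map (γ : F.graph ≃g F.graph) f).subset ?_
  rintro e ⟨he, x, hx, hxB⟩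
  obtain ⟨f, hf, γ, hγ, rfl⟩ := hTe e he
  refine Set.mem_biUnion hf ⟨⟨γ, hγ⟩, ?_, rfl⟩
  have h1 := (F.mem_edgeSegment_map hγ f (x - F.π (Additive.ofMul ⟨γ, hγ⟩))).1 (by simpa using hx)
  have h2 := hr f _ h1
  have h3 := norm_sub_le x (x - F.π (Additive.ofMul ⟨γ, hγ⟩))
  rw [sub_sub_cancel] at h3
  have := hR x hxB
  change ‖_‖ ≤ _
  linarith

theorem isClosed_union_edges {S : Set (Sym2 V)} (hS : S ⊆ F.graph.edgeSet) :
    IsClosed (⋃ e ∈ S, F.edgeSegment e) := by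
  rw [Set.biUnion_eq_iUnion]
  refine LocallyFinite.isClosed_iUnion ?_ fun e => (F.isCompact_edgeSegment e).isClosed
  intro x
  refine ⟨Metric.ball x 1, Metric.ball_mem_nhds x one_pos, ?_⟩
  refine Set.Finite.of_finite_image (f := Subtype.val)
    ((F.finite_edges_meeting (B := Metric.ball x 1) Metric.isBounded_ball).subset ?_)
    Subtype.val_injective.injOn
  rintro _ ⟨e, he, rfl⟩
  exact ⟨hS e.2, he⟩

theorem isClosed_skeleton : IsClosed F.skeleton := by
  have : F.skeleton = ⋃ e ∈ F.graph.edgeSet, F.edgeSegment e := by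
    ext x
    simp [mem_skeleton_iff]
  rw [this]
  exact F.isClosed_union_edges subset_rfl

/-! ### Faces -/

variable {F}

theorem isOpen_of_mem_faces {U : Set Plane} (hU : U ∈ F.faces) : IsOpen U := by
  obtain ⟨x, hx, rfl⟩ := hU
  exact F.isClosed_skeleton.isOpen_compl.connectedComponentIn

theorem subset_compl_of_mem_faces {U : Set Plane} (hU : U ∈ F.faces) : U ⊆ F.skeletonᶜ := by
  obtain ⟨x, hx, rfl⟩ := hU
  exact connectedComponentIn_subset _ _

theorem isConnected_of_mem_faces {U : Set Plane} (hU : U ∈ F.faces) : IsConnected U := by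
  obtain ⟨x, hx, rfl⟩ := hU
  exact isConnected_connectedComponentIn_iff.2 hx

theorem exists_mem_faces {x : Plane} (hx : x ∉ F.skeleton) : ∃ U ∈ F.faces, x ∈ U :=
  ⟨_, ⟨x, hx, rfl⟩, mem_connectedComponentIn hx⟩

theorem subset_of_mem_faces {U s : Set Plane} (hU : U ∈ F.faces) (hs : IsPreconnected s)
    (hsk : Disjoint s F.skeleton) {x : Plane} (hx : x ∈ s) (hxU : x ∈ U) : s ⊆ U := by
  obtain ⟨y, hy, rfl⟩ := hU
  rw [connectedComponentIn_eq hxU]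
  exact hs.subset_connectedComponentIn hx hsk.subset_compl_right

theorem eq_of_mem_faces {U W : Set Plane} (hU : U ∈ F.faces) (hW : W ∈ F.faces) {x : Plane}
    (hxU : x ∈ U) (hxW : x ∈ W) : U = W := by
  have hd : ∀ {U}, U ∈ F.faces → Disjoint U F.skeleton := fun h =>
    Set.disjoint_left.2 fun _ hx => subset_compl_of_mem_faces h hx
  exact (subset_of_mem_faces hW (isConnected_of_mem_faces hU).isPreconnected (hd hU) hxU hxW).antisymm
    (subset_of_mem_faces hU (isConnected_of_mem_faces hW).isPreconnected (hd hW) hxW hxU)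

theorem exists_face_superset {s : Set Plane} (hs : IsPreconnected s)
    (hne : s.Nonempty) (hsk : Disjoint s F.skeleton) : ∃ U ∈ F.faces, s ⊆ U := by
  obtain ⟨x, hx⟩ := hne
  obtain ⟨U, hU, hxU⟩ := exists_mem_faces (Set.disjoint_left.1 hsk hx)
  exact ⟨U, hU, subset_of_mem_faces hU hs hsk hx hxU⟩

/-! ### The two sides of an edge -/

/-- Non-crossing speaks of pairs of edges only, so the vertex is tested through some edge at it. The
common point is then a common endpoint, and `placement` excludes the other end of that edge. -/
theorem NonCrossing.mem_of_p_mem (hF : F.NonCrossing) {v : V} {e : Sym2 V}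
    (he : e ∈ F.graph.edgeSet) (h : F.p v ∈ F.edgeSegment e) : v ∈ e := by
  obtain ⟨u, hu⟩ := F.exists_adj v
  by_cases hee : e = s(v, u)
  · rw [hee]; exact Sym2.mem_mk_left v u
  · obtain ⟨v', ⟨h1, h2⟩, h3⟩ := hF e he s(v, u) hu hee
      ⟨h, F.p_mem_edgeSegment (Sym2.mem_mk_left v u)⟩
    rcases Sym2.mem_iff.1 h2 with rfl | rfl
    · exact h1
    · exact absurd h3.symm (F.placement _ _ hu)

theorem ne_of_mem_openSegment {a b q : Plane} (hab : a ≠ b) (hq : q ∈ openSegment ℝ a b) :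
    q ≠ a ∧ q ≠ b := by
  constructor
  · rintro rfl
    exact hab (left_mem_openSegment_iff.1 hq)
  · rintro rfl
    exact hab (right_mem_openSegment_iff.1 hq)

theorem NonCrossing.eq_of_mem_openSegment (hF : F.NonCrossing) {a b : V} (hab : F.graph.Adj a b)
    {q : Plane} (hq : q ∈ openSegment ℝ (F.p a) (F.p b)) {e : Sym2 V} (he : e ∈ F.graph.edgeSet)
    (hqe : q ∈ F.edgeSegment e) : e = s(a, b) := by
  by_contra hee
  obtain ⟨v, ⟨h1, h2⟩, h3⟩ := hF e he s(a, b) hab hee ⟨hqe, openSegment_subset_segment _ _ _ hq⟩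
  have := ne_of_mem_openSegment (F.placement _ _ hab) hq
  rcases Sym2.mem_iff.1 h2 with rfl | rfl
  · exact this.1 h3.symm
  · exact this.2 h3.symm

theorem crossTerm_eq_zero_of_mem_segment {a b x : Plane} (h : x ∈ segment ℝ a b) :
    crossTerm a b x = 0 := by
  rw [mem_segment_iff_coord] at h
  obtain ⟨t, -, -, hx, hy⟩ := h
  unfold crossTerm
  rw [hx, hy]; ring

theorem coord_dist_sq_pos {a b : Plane} (hab : a ≠ b) :
    0 < (b 0 - a 0) ^ 2 + (b 1 - a 1) ^ 2 := by
  by_contra hD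
  have h0 : (b 0 - a 0) ^ 2 = 0 := by nlinarith [sq_nonneg (b 0 - a 0), sq_nonneg (b 1 - a 1)]
  have h1 : (b 1 - a 1) ^ 2 = 0 := by nlinarith [sq_nonneg (b 0 - a 0), sq_nonneg (b 1 - a 1)]
  apply hab
  ext i
  fin_cases i
  · exact (sub_eq_zero.1 (pow_eq_zero_iff two_ne_zero |>.1 h0)).symm
  · exact (sub_eq_zero.1 (pow_eq_zero_iff two_ne_zero |>.1 h1)).symm

theorem eventually_mem_segment_of_crossTerm {a b q : Plane} (hab : a ≠ b)
    (hq : q ∈ openSegment ℝ a b) : ∀ᶠ x in 𝓝 q, crossTerm a b x = 0 → x ∈ segment ℝ a b := by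
  rw [mem_openSegment_iff_coord] at hq
  obtain ⟨t, h0, h1, hx, hy⟩ := hq
  let D := (b 0 - a 0) ^ 2 + (b 1 - a 1) ^ 2
  have hD : 0 < D := coord_dist_sq_pos hab
  -- The parameter of the orthogonal projection to the line, which stays in (0, 1) near `q`.
  let τ : Plane → ℝ := fun x => ((x 0 - a 0) * (b 0 - a 0) + (x 1 - a 1) * (b 1 - a 1)) / D
  have hτ : Continuous τ := by
    apply Continuous.div_const
    fun_prop
  have hτq : τ q = t := by
    simp only [τ]
    rw [hx, hy, div_eq_iff hD.ne']
    simp only [D]; ring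
  filter_upwards [hτ.continuousAt.eventually (lt_mem_nhds (hτq ▸ h0 : 0 < τ q)),
    hτ.continuousAt.eventually (gt_mem_nhds (hτq ▸ h1 : τ q < 1))] with x hx0 hx1 hc
  rw [mem_segment_iff_coord]
  refine ⟨τ x, hx0.le, hx1.le, ?_, ?_⟩
  · simp only [τ]
    field_simp
    unfold crossTerm at hc
    simp only [D]
    linear_combination (-(b 1 - a 1)) * hc
  · simp only [τ]
    field_simp
    unfold crossTerm at hc
    simp only [D]
    linear_combination (b 0 - a 0) * hc

theorem frequently_crossTerm_pos {a b q : Plane} (hab : a ≠ b) (hq : crossTerm a b q = 0) :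
    ∃ᶠ x in 𝓝 q, 0 < crossTerm a b x := by
  -- Leave `q` perpendicularly to the segment, towards its left.
  let f : ℝ → Plane := fun t => q + t • !₂[-(b 1 - a 1), b 0 - a 0]
  have hf : Continuous f := by fun_prop
  have hf0 : Tendsto f (𝓝[>] 0) (𝓝 q) := by
    have := hf.tendsto 0
    simp only [f, zero_smul, add_zero] at this
    exact this.mono_left nhdsWithin_le_nhds
  refine hf0.frequently (Eventually.frequently ?_)
  filter_upwards [self_mem_nhdsWithin] with t (ht : 0 < t)
  have : crossTerm a b (f t) = t * ((b 0 - a 0) ^ 2 + (b 1 - a 1) ^ 2) := by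
    unfold crossTerm at hq ⊢
    simp [f]
    linear_combination hq
  rw [this]
  exact mul_pos ht (coord_dist_sq_pos hab)

theorem frequently_crossTerm_neg {a b q : Plane} (hab : a ≠ b) (hq : crossTerm a b q = 0) :
    ∃ᶠ x in 𝓝 q, crossTerm a b x < 0 := by
  refine (frequently_crossTerm_pos hab.symm (q := q) (by rw [crossTerm_swap, hq, neg_zero])).mono ?_
  intro x hx
  rw [crossTerm_swap] at hx
  linarith

theorem convex_crossTerm_pos (a b : Plane) : Convex ℝ {x | 0 < crossTerm a b x} := by
  intro x hx y hy s t hs ht hst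
  simp only [Set.mem_ofPred_eq] at hx hy ⊢
  have : crossTerm a b (s • x + t • y) = s * crossTerm a b x + t * crossTerm a b y := by
    unfold crossTerm
    simp
    obtain rfl : t = 1 - s := by linarith
    ring
  rw [this]
  rcases hs.eq_or_lt with rfl | hs
  · obtain rfl : t = 1 := by linarith
    linarith
  · exact add_pos_of_pos_of_nonneg (mul_pos hs hx) (mul_nonneg ht hy.le)

/-- The other edges form a closed set missing `q`, so near `q` the skeleton is a piece of a line. -/
theorem NonCrossing.eventually_mem_skeleton_iff (hF : F.NonCrossing) {a b : V}
    (hab : F.graph.Adj a b) {q : Plane} (hq : q ∈ openSegment ℝ (F.p a) (F.p b)) :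
    ∀ᶠ x in 𝓝 q, x ∈ F.skeleton ↔ crossTerm (F.p a) (F.p b) x = 0 := by
  have hcl := F.isClosed_union_edges (S := F.graph.edgeSet \ {s(a, b)}) Set.sdiff_subset
  have hnq : q ∉ ⋃ e ∈ F.graph.edgeSet \ {s(a, b)}, F.edgeSegment e := by
    simp only [Set.mem_iUnion, not_exists]
    rintro e ⟨he, hne⟩ hqe
    exact hne (hF.eq_of_mem_openSegment hab hq he hqe)
  filter_upwards [hcl.isOpen_compl.mem_nhds hnq,
    eventually_mem_segment_of_crossTerm (F.placement _ _ hab) hq] with x hx1 hx2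
  constructor
  · intro hx
    obtain ⟨e, he, hxe⟩ := F.mem_skeleton_iff.1 hx
    by_cases hee : e = s(a, b)
    · subst hee
      exact crossTerm_eq_zero_of_mem_segment hxe
    · exact absurd (Set.mem_biUnion (show e ∈ F.graph.edgeSet \ {s(a, b)} from ⟨he, hee⟩) hxe) hx1
  · intro h
    exact F.edgeSegment_subset_skeleton (e := s(a, b)) hab (hx2 h)

/-- A small open half-disc on the left is convex and avoids the skeleton. -/
theorem NonCrossing.exists_left_face_at (hF : F.NonCrossing) {a b : V}
    (hab : F.graph.Adj a b) {q : Plane} (hq : q ∈ openSegment ℝ (F.p a) (F.p b)) :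
    ∃ U ∈ F.faces, ∀ᶠ x in 𝓝 q, 0 < crossTerm (F.p a) (F.p b) x → x ∈ U := by
  obtain ⟨ε, hε, h⟩ := Metric.eventually_nhds_iff_ball.1 (hF.eventually_mem_skeleton_iff hab hq)
  have hconv : Convex ℝ (Metric.ball q ε ∩ {x | 0 < crossTerm (F.p a) (F.p b) x}) :=
    (convex_ball q ε).inter (convex_crossTerm_pos _ _)
  obtain ⟨U, hU, hsub⟩ := exists_face_superset (F := F) hconv.isPreconnected
    (by
      obtain ⟨x, hx⟩ := ((frequently_crossTerm_pos (F.placement _ _ hab)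
        (crossTerm_eq_zero_of_mem_segment (openSegment_subset_segment _ _ _ hq))).and_eventually
        (Metric.ball_mem_nhds q hε)).exists
      exact ⟨x, hx.2, hx.1⟩)
    (Set.disjoint_left.2 fun x hx hxs => hx.2.ne' ((h x hx.1).1 hxs))
  refine ⟨U, hU, ?_⟩
  filter_upwards [Metric.ball_mem_nhds q hε] with x hx hpos using hsub ⟨hx, hpos⟩

/-- The half-discs at nearby points of the open segment overlap, so the face on the left is locally
constant along a connected set. -/
theorem NonCrossing.exists_left_face (hF : F.NonCrossing) {a b : V} (hab : F.graph.Adj a b) :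
    ∃ U ∈ F.faces, ∀ q ∈ openSegment ℝ (F.p a) (F.p b),
      ∀ᶠ x in 𝓝 q, 0 < crossTerm (F.p a) (F.p b) x → x ∈ U := by
  choose! L hL hLx using fun q (hq : q ∈ openSegment ℝ (F.p a) (F.p b)) =>
    hF.exists_left_face_at hab hq
  have hpre : IsPreconnected (openSegment ℝ (F.p a) (F.p b)) :=
    (convex_openSegment _ _).isPreconnected
  obtain ⟨q₀, hq₀⟩ : (openSegment ℝ (F.p a) (F.p b)).Nonempty :=
    ⟨_, mem_openSegment_iff_div.2 ⟨1, 1, one_pos, one_pos, rfl⟩⟩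
  have hconst : ∀ q ∈ openSegment ℝ (F.p a) (F.p b), L q₀ = L q := by
    intro q hq
    refine hpre.induction₂ (fun x y => L x = L y) ?_ (fun _ _ _ _ _ _ => Eq.trans)
      (fun _ _ _ _ => Eq.symm) hq₀ hq
    intro x hx
    filter_upwards [eventually_nhdsWithin_of_eventually_nhds (hLx x hx).eventually_nhds,
      self_mem_nhdsWithin] with y hy hys
    obtain ⟨z, hz1, hz2, hz3⟩ := ((frequently_crossTerm_pos (F.placement _ _ hab)
        (crossTerm_eq_zero_of_mem_segment (openSegment_subset_segment _ _ _ hys))).and_eventually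
        (hy.and (hLx y hys))).exists
    exact eq_of_mem_faces (hL x hx) (hL y hys) (hz2 hz1) (hz3 hz1)
  exact ⟨L q₀, hL _ hq₀, fun q hq => hconst q hq ▸ hLx q hq⟩

open scoped Classical in
variable (F) in
/-- The face to the left of a directed edge. -/
def leftFace (a b : V) : Set Plane :=
  -- The value `∅` is junk; it does not occur for adjacent vertices of a non-crossing framework.
  if h : ∃ U ∈ F.faces, ∀ q ∈ openSegment ℝ (F.p a) (F.p b),
      ∀ᶠ x in 𝓝 q, 0 < crossTerm (F.p a) (F.p b) x → x ∈ U then h.choose else ∅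

theorem NonCrossing.leftFace_mem (hF : F.NonCrossing) {a b : V} (hab : F.graph.Adj a b) :
    F.leftFace a b ∈ F.faces := by
  rw [leftFace, dif_pos (hF.exists_left_face hab)]
  exact (hF.exists_left_face hab).choose_spec.1

theorem NonCrossing.eventually_mem_leftFace (hF : F.NonCrossing) {a b : V}
    (hab : F.graph.Adj a b) {q : Plane} (hq : q ∈ openSegment ℝ (F.p a) (F.p b)) :
    ∀ᶠ x in 𝓝 q, (0 < crossTerm (F.p a) (F.p b) x → x ∈ F.leftFace a b) ∧
      (crossTerm (F.p a) (F.p b) x < 0 → x ∈ F.leftFace b a) := by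
  have key {a b : V} (hab : F.graph.Adj a b) (hq : q ∈ openSegment ℝ (F.p a) (F.p b)) :
      ∀ᶠ x in 𝓝 q, 0 < crossTerm (F.p a) (F.p b) x → x ∈ F.leftFace a b := by
    rw [leftFace, dif_pos (hF.exists_left_face hab)]
    exact (hF.exists_left_face hab).choose_spec.2 q hq
  filter_upwards [key hab hq, key hab.symm (by rwa [openSegment_symm])] with x h1 h2
  refine ⟨h1, fun h => h2 ?_⟩
  rw [crossTerm_swap]
  linarith

/-! ### Parity of finite cycles -/

/-- The sum of the values of a function at the endpoints of an edge. -/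
def edgeSum {M : Type*} [AddCommMonoid M] (φ : V → M) : Sym2 V → M :=
  Sym2.lift ⟨fun a b => φ a + φ b, fun _ _ => add_comm _ _⟩

@[simp]
theorem edgeSum_mk {M : Type*} [AddCommMonoid M] (φ : V → M) (a b : V) :
    edgeSum φ s(a, b) = φ a + φ b := rfl

variable (F) in
/-- The boundary map from chains of edges to chains of vertices, modulo two. -/
def bdry₁ : (F.graph.edgeSet →₀ ZMod 2) →ₗ[ZMod 2] (V →₀ ZMod 2) :=
  Finsupp.linearCombination (ZMod 2)
    fun e : F.graph.edgeSet => edgeSum (fun v => Finsupp.single v (1 : ZMod 2)) (e : Sym2 V)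

/-- Pairing `z` with the coboundary of `φ` is pairing its boundary with `φ`. This is why crossing
parities matter only up to terms attached to endpoints. -/
theorem sum_mul_edgeSum_eq_zero {z : F.graph.edgeSet →₀ ZMod 2} (hz : F.bdry₁ z = 0)
    (φ : V → ZMod 2) : ∑ e ∈ z.support, z e * edgeSum φ (e : Sym2 V) = 0 := by
  have h : ∀ z : F.graph.edgeSet →₀ ZMod 2, Finsupp.linearCombination (ZMod 2) φ (F.bdry₁ z) =
      Finsupp.linearCombination (ZMod 2) (fun e : F.graph.edgeSet => edgeSum φ (e : Sym2 V)) z := by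
    intro z
    induction z using Finsupp.induction_linear with
    | zero => simp
    | add f g hf hg => simp [hf, hg]
    | single e c =>
      obtain ⟨e, he⟩ := e
      induction e using Sym2.ind with | _ a b =>
      simp [bdry₁, mul_add]
  have := h z
  rw [hz, map_zero, Finsupp.linearCombination_apply, Finsupp.sum] at this
  simpa using this.symm

variable (F) in
/-- The crossing parity of an edge. -/
def edgeCross (x : Plane) : Sym2 V → ZMod 2 :=
  Sym2.lift ⟨fun a b => crossInd (F.p a) (F.p b) x, fun _ _ => crossInd_comm _ _ _⟩

/-- The parity of a point with respect to a chain of edges. -/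
def parity (z : F.graph.edgeSet →₀ ZMod 2) (x : Plane) : ZMod 2 :=
  ∑ e ∈ z.support, z e * F.edgeCross x (e : Sym2 V)

theorem parity_eq_of_cross_eq {z : F.graph.edgeSet →₀ ZMod 2} (hz : F.bdry₁ z = 0) (x : Plane)
    (φ : V → ZMod 2) (c : F.graph.edgeSet → ZMod 2)
    (h : ∀ e ∈ z.support, F.edgeCross x (e : Sym2 V) = edgeSum φ (e : Sym2 V) + c e) :
    parity z x = ∑ e ∈ z.support, z e * c e := by
  rw [parity, Finset.sum_congr rfl fun e he => by rw [h e he, mul_add], Finset.sum_add_distrib,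
    sum_mul_edgeSum_eq_zero hz, zero_add]

theorem edgeCross_locally {e : Sym2 V} {q : Plane} (hq : q ∉ F.edgeSegment e) :
    ∃ c, ∀ᶠ x in 𝓝 q, F.edgeCross x e =
      edgeSum (fun v => rightInd q (F.p v) * aboveInd (F.p v) x) e + c := by
  induction e using Sym2.ind with | _ a b =>
  exact crossInd_locally hq

theorem parity_eventually_eq {z : F.graph.edgeSet →₀ ZMod 2} (hz : F.bdry₁ z = 0) {q : Plane}
    (hq : q ∉ F.skeleton) : ∀ᶠ x in 𝓝 q, parity z q = parity z x := by
  choose c hc using fun e : F.graph.edgeSet => edgeCross_locally (F := F) (e := e) (q := q)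
    fun h => hq (F.edgeSegment_subset_skeleton e.2 h)
  have : ∀ᶠ x in 𝓝 q, parity z x = ∑ e ∈ z.support, z e * c e := by
    have := (Finset.eventually_all z.support).2 fun e _ => hc e
    filter_upwards [this] with x hx
    exact parity_eq_of_cross_eq hz x _ c hx
  have hq' := this.self_of_nhds
  filter_upwards [this] with x hx
  rw [hx, hq']

theorem parity_eq_of_mem_face {z : F.graph.edgeSet →₀ ZMod 2} (hz : F.bdry₁ z = 0)
    {U : Set Plane} (hU : U ∈ F.faces) {x y : Plane} (hx : x ∈ U) (hy : y ∈ U) :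
    parity z x = parity z y := by
  refine (isConnected_of_mem_faces hU).isPreconnected.induction₂ (fun x y => parity z x = parity z y)
    ?_ (fun _ _ _ _ _ _ => Eq.trans) (fun _ _ _ _ => Eq.symm) hx hy
  exact fun q hq => eventually_nhdsWithin_of_eventually_nhds
    (parity_eventually_eq hz (subset_compl_of_mem_faces hU hq))

-- Only the edge `ab` passes through `q`. All other edges contribute constants modulo endpoint
-- terms, and `ab` contributes a jump weighted by its coefficient.
open scoped Classical in
theorem NonCrossing.parity_jump (hF : F.NonCrossing) {z : F.graph.edgeSet →₀ ZMod 2}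
    (hz : F.bdry₁ z = 0) {a b : V} (hab : F.graph.Adj a b) {q : Plane}
    (hq : q ∈ openSegment ℝ (F.p a) (F.p b)) :
    ∃ c, ∀ᶠ x in 𝓝 q, (0 < crossTerm (F.p a) (F.p b) x → parity z x = c) ∧
      (crossTerm (F.p a) (F.p b) x < 0 → parity z x = c + z ⟨s(a, b), hab⟩) := by
  have key : ∀ e : F.graph.edgeSet, ∃ c, ∀ᶠ x in 𝓝 q,
      (0 < crossTerm (F.p a) (F.p b) x → F.edgeCross x (e : Sym2 V) =
        edgeSum (fun v => rightInd q (F.p v) * aboveInd (F.p v) x) (e : Sym2 V) + c) ∧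
      (crossTerm (F.p a) (F.p b) x < 0 → F.edgeCross x (e : Sym2 V) =
        edgeSum (fun v => rightInd q (F.p v) * aboveInd (F.p v) x) (e : Sym2 V) +
          (c + if e = ⟨s(a, b), hab⟩ then 1 else 0)) := by
    intro e
    by_cases he : e = ⟨s(a, b), hab⟩
    · subst he
      simpa [add_assoc] using! crossInd_jump (F.placement _ _ hab) hq
    · obtain ⟨c, hc⟩ := edgeCross_locally (F := F) (e := e) (q := q)
        fun h => he (Subtype.ext (hF.eq_of_mem_openSegment hab hq e.2 h))
      refine ⟨c, hc.mono fun x hx => ?_⟩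
      simp [he, hx]
  choose c hc using key
  refine ⟨∑ e ∈ z.support, z e * c e, ?_⟩
  filter_upwards [(Finset.eventually_all z.support).2 fun e _ => hc e] with x hx
  refine ⟨fun h => parity_eq_of_cross_eq hz x _ c fun e he => (hx e he).1 h, fun h => ?_⟩
  rw [parity_eq_of_cross_eq hz x _ _ fun e he => (hx e he).2 h]
  simp only [mul_add, Finset.sum_add_distrib]
  congr 1
  simp only [mul_ite, mul_one, mul_zero, Finset.sum_ite_eq', Finsupp.mem_support_iff]
  split_ifs with h
  · rfl
  · exact (not_not.1 h).symm

/-- Far away every crossing parity is a sum of endpoint terms with one common factor, and these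
cancel on a cycle. -/
theorem exists_parity_eq_zero {z : F.graph.edgeSet →₀ ZMod 2} (hz : F.bdry₁ z = 0) :
    ∃ R, ∀ x, R < ‖x‖ → parity z x = 0 := by
  have hR : ∃ R, ∀ e ∈ z.support, ∀ x ∈ F.edgeSegment (e : Sym2 V), ‖x‖ ≤ R := by
    have : Bornology.IsBounded (⋃ e ∈ z.support, F.edgeSegment (e : Sym2 V)) :=
      (Bornology.isBounded_biUnion_finset _).2 fun e _ => (F.isCompact_edgeSegment e).isBounded
    obtain ⟨R, hR⟩ := this.exists_norm_le
    exact ⟨R, fun e he x hx => hR x (Set.mem_biUnion he hx)⟩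
  obtain ⟨R, hR⟩ := hR
  refine ⟨2 * R, fun x hx => ?_⟩
  obtain ⟨s, hs⟩ := crossInd_far hx
  rw [parity_eq_of_cross_eq hz x (fun v => s * aboveInd (F.p v) x) 0]
  · simp
  · rintro ⟨e, he'⟩ he
    have := hR _ he
    clear he
    induction e using Sym2.ind with | _ a b =>
    rw [Pi.zero_apply, add_zero]
    exact hs _ _ (this _ (left_mem_segment ..)) (this _ (right_mem_segment ..))

/-! ### Boundaries of faces -/

/-- This describes the edges of the cycle by the frontier alone, so that the chosen walk can be
forgotten. An interior point of an edge lies on no other edge. -/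
theorem NonCrossing.mem_edges_iff (hF : F.NonCrossing) {U : Set Plane} {v : V}
    {w : F.graph.Walk v v} (hw : F.IsBoundaryCycle U w) {e : Sym2 V} (he : e ∈ F.graph.edgeSet) :
    e ∈ w.edges ↔ F.edgeSegment e ⊆ frontier U := by
  constructor
  · intro h
    rw [hw.2]
    exact Set.subset_biUnion_of_mem (u := fun e => F.edgeSegment e) h
  · intro h
    induction e using Sym2.ind with | _ a b =>
    obtain ⟨q, hq⟩ : (openSegment ℝ (F.p a) (F.p b)).Nonempty :=
      ⟨_, mem_openSegment_iff_div.2 ⟨1, 1, one_pos, one_pos, rfl⟩⟩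
    have := h (openSegment_subset_segment _ _ _ hq)
    rw [hw.2] at this
    obtain ⟨e, he', hqe⟩ := Set.mem_iUnion₂.1 this
    rwa [← hF.eq_of_mem_openSegment he hq (w.edges_subset_edgeSet he') hqe]

theorem NonCrossing.mem_support_iff (hF : F.NonCrossing) {U : Set Plane} {v : V}
    {w : F.graph.Walk v v} (hw : F.IsBoundaryCycle U w) {u : V} :
    u ∈ w.support ↔ F.p u ∈ frontier U := by
  rw [hw.2]
  constructor
  · intro h
    rw [SimpleGraph.Walk.mem_support_iff_exists_mem_edges_of_not_nil hw.1.not_nil] at h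
    obtain ⟨e, he, hu⟩ := h
    exact Set.mem_biUnion he (F.p_mem_edgeSegment hu)
  · intro h
    obtain ⟨e, he, hue⟩ := Set.mem_iUnion₂.1 h
    exact w.mem_support_of_mem_edges he
      (hF.mem_of_p_mem (w.edges_subset_edgeSet he) hue)

theorem NonCrossing.mem_frontier_iff (hF : F.NonCrossing) {a b : V} (hab : F.graph.Adj a b)
    {q : Plane} (hq : q ∈ openSegment ℝ (F.p a) (F.p b)) {U : Set Plane} (hU : U ∈ F.faces) :
    q ∈ frontier U ↔ U = F.leftFace a b ∨ U = F.leftFace b a := by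
  have hqs : q ∈ F.skeleton := F.edgeSegment_subset_skeleton (e := s(a, b)) hab
    (openSegment_subset_segment _ _ _ hq)
  have hcT := crossTerm_eq_zero_of_mem_segment (openSegment_subset_segment _ _ _ hq)
  rw [(isOpen_of_mem_faces hU).frontier_eq]
  constructor
  · rintro ⟨h, -⟩
    obtain ⟨x, hxU, h1, h2⟩ := ((mem_closure_iff_frequently.1 h).and_eventually
      ((hF.eventually_mem_leftFace hab hq).and (hF.eventually_mem_skeleton_iff hab hq))).exists
    have hx : crossTerm (F.p a) (F.p b) x ≠ 0 := fun h0 =>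
      subset_compl_of_mem_faces hU hxU (h2.2 h0)
    rcases hx.lt_or_gt with hx | hx
    · exact .inr (eq_of_mem_faces hU (hF.leftFace_mem hab.symm) hxU (h1.2 hx))
    · exact .inl (eq_of_mem_faces hU (hF.leftFace_mem hab) hxU (h1.1 hx))
  · intro h
    refine ⟨mem_closure_iff_frequently.2 ?_, fun h => subset_compl_of_mem_faces hU h hqs⟩
    rcases h with rfl | rfl
    · exact ((frequently_crossTerm_pos (F.placement _ _ hab) hcT).and_eventually
        (hF.eventually_mem_leftFace hab hq)).mono fun x hx => hx.2.1 hx.1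
    · exact ((frequently_crossTerm_neg (F.placement _ _ hab) hcT).and_eventually
        (hF.eventually_mem_leftFace hab hq)).mono fun x hx => hx.2.2 hx.1

theorem NonCrossing.edgeSegment_subset_frontier_iff (hF : F.NonCrossing) {a b : V}
    (hab : F.graph.Adj a b) {U : Set Plane} (hU : U ∈ F.faces) :
    F.edgeSegment s(a, b) ⊆ frontier U ↔ U = F.leftFace a b ∨ U = F.leftFace b a := by
  constructor
  · intro h
    obtain ⟨q, hq⟩ : (openSegment ℝ (F.p a) (F.p b)).Nonempty :=
      ⟨_, mem_openSegment_iff_div.2 ⟨1, 1, one_pos, one_pos, rfl⟩⟩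
    exact (hF.mem_frontier_iff hab hq hU).1 (h (openSegment_subset_segment _ _ _ hq))
  · intro h
    rw [edgeSegment_mk, ← closure_openSegment]
    exact isClosed_frontier.closure_subset_iff.2 fun q hq => (hF.mem_frontier_iff hab hq hU).2 h

open scoped Classical in
variable (F) in
/-- The chain of the edges on the boundary of a set. -/
def boundaryChain (U : Set Plane) : F.graph.edgeSet →₀ ZMod 2 :=
  -- Zero is a default value; for faces the set is finite by `finite_boundary_edges`.
  if h : {e : F.graph.edgeSet | F.edgeSegment e ⊆ frontier U}.Finite then
    Finsupp.indicator h.toFinset fun _ _ => 1 else 0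

theorem finite_boundary_edges (hF : F.IsPointedPseudoTriangulation) {U : Set Plane}
    (hU : U ∈ F.faces) : {e : F.graph.edgeSet | F.edgeSegment e ⊆ frontier U}.Finite := by
  classical
  obtain ⟨v, w, hw, -⟩ := hF.pseudoTriangle U hU
  refine Set.Finite.of_finite_image (f := Subtype.val) (w.edges.toFinset.finite_toSet.subset ?_)
    Subtype.val_injective.injOn
  rintro _ ⟨e, he, rfl⟩
  simpa using (hF.nonCrossing.mem_edges_iff hw e.2).2 he

open scoped Classical in
theorem boundaryChain_apply (hF : F.IsPointedPseudoTriangulation) {U : Set Plane}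
    (hU : U ∈ F.faces) (e : F.graph.edgeSet) :
    F.boundaryChain U e = if F.edgeSegment e ⊆ frontier U then 1 else 0 := by
  rw [boundaryChain, dif_pos (finite_boundary_edges hF hU), Finsupp.indicator_apply]
  simp

theorem sum_map_edgeSum_edges {M : Type*} [AddCommGroup M] [Module (ZMod 2) M] (φ : V → M)
    {G : SimpleGraph V} {u v : V} (w : G.Walk u v) :
    (w.edges.map (edgeSum φ)).sum = φ u + φ v := by
  have h2 : ∀ m : M, m + m = 0 := ZModModule.add_self
  induction w with
  | nil => simp [h2]
  | @cons u v' w h p ih =>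
    rw [SimpleGraph.Walk.edges_cons, List.map_cons, List.sum_cons, ih, edgeSum_mk, add_assoc,
      ← add_assoc (φ v'), h2, zero_add]

/-- The boundary is a closed walk without repeated edges, along which the endpoints telescope mod 2.
-/
theorem bdry₁_boundaryChain (hF : F.IsPointedPseudoTriangulation) {U : Set Plane}
    (hU : U ∈ F.faces) : F.bdry₁ (F.boundaryChain U) = 0 := by
  classical
  obtain ⟨v, w, hw, -⟩ := hF.pseudoTriangle U hU
  rw [bdry₁, Finsupp.linearCombination_apply, Finsupp.sum]
  have h1 : ∀ e ∈ (F.boundaryChain U).support,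
      F.boundaryChain U e • edgeSum (fun v => Finsupp.single v (1 : ZMod 2)) (e : Sym2 V) =
      edgeSum (fun v => Finsupp.single v (1 : ZMod 2)) (e : Sym2 V) := by
    intro e he
    rw [Finsupp.mem_support_iff, boundaryChain_apply hF hU] at he
    rw [boundaryChain_apply hF hU, if_pos (by simpa using he), one_smul]
  rw [Finset.sum_congr rfl h1]
  have h2 : (F.boundaryChain U).support.map (Function.Embedding.subtype _) =
      w.edges.toFinset := by
    ext e
    simp only [Finset.mem_map, Finsupp.mem_support_iff, boundaryChain_apply hF hU,
      Function.Embedding.subtype_apply, List.mem_toFinset]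
    constructor
    · rintro ⟨e, he, rfl⟩
      exact (hF.nonCrossing.mem_edges_iff hw e.2).2 (by simpa using he)
    · intro he
      have he' := w.edges_subset_edgeSet he
      exact ⟨⟨e, he'⟩, by simpa using (hF.nonCrossing.mem_edges_iff hw he').1 he, rfl⟩
  refine (Finset.sum_map _ (Function.Embedding.subtype _)
    (edgeSum fun v => Finsupp.single v (1 : ZMod 2))).symm.trans ?_
  rw [h2, List.sum_toFinset _ hw.1.edges_nodup, sum_map_edgeSum_edges, ZModModule.add_self]

/-- The two sides of an edge are different faces. -/
theorem leftFace_ne (hF : F.IsPointedPseudoTriangulation) {a b : V} (hab : F.graph.Adj a b) :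
    F.leftFace a b ≠ F.leftFace b a := by
  intro heq
  have hnc := hF.nonCrossing
  have hU := hnc.leftFace_mem hab
  obtain ⟨q, hq⟩ : (openSegment ℝ (F.p a) (F.p b)).Nonempty :=
    ⟨_, mem_openSegment_iff_div.2 ⟨1, 1, one_pos, one_pos, rfl⟩⟩
  have hcT := crossTerm_eq_zero_of_mem_segment (openSegment_subset_segment _ _ _ hq)
  -- If both sides were the face `U`, the parity for the boundary chain of `U` would be constant on
  -- `U`, yet it jumps across the boundary edge `ab`.
  have hz := bdry₁_boundaryChain hF hU
  obtain ⟨c, hc⟩ := hnc.parity_jump hz hab hq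
  have hev := hc.and (hnc.eventually_mem_leftFace hab hq)
  obtain ⟨x, hx, hx1, hx2⟩ := ((frequently_crossTerm_pos (F.placement _ _ hab) hcT).and_eventually
    hev).exists
  obtain ⟨y, hy, hy1, hy2⟩ := ((frequently_crossTerm_neg (F.placement _ _ hab) hcT).and_eventually
    hev).exists
  have h := parity_eq_of_mem_face hz hU (hx2.1 hx) (heq ▸ hy2.2 hy)
  rw [hx1.1 hx, hy1.2 hy, boundaryChain_apply hF hU, if_pos
    ((hnc.edgeSegment_subset_frontier_iff hab hU).2 (.inl rfl))] at h
  simp at h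

/-! ### Faces as chains and exactness of the mod 2 complex at the edges -/

variable (F) in
/-- The boundary map from chains of faces to chains of edges, modulo two. -/
def bdry₂ : (F.faces →₀ ZMod 2) →ₗ[ZMod 2] (F.graph.edgeSet →₀ ZMod 2) :=
  Finsupp.linearCombination (ZMod 2) fun U : F.faces => F.boundaryChain U

/-- An edge bounds precisely its two sides; as these are different faces, their two contributions do
not collapse into one. -/
theorem bdry₂_apply (hF : F.IsPointedPseudoTriangulation) (f : F.faces →₀ ZMod 2) {a b : V}
    (hab : F.graph.Adj a b) : F.bdry₂ f ⟨s(a, b), hab⟩ =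
      f ⟨F.leftFace a b, hF.nonCrossing.leftFace_mem hab⟩ +
      f ⟨F.leftFace b a, hF.nonCrossing.leftFace_mem hab.symm⟩ := by
  classical
  induction f using Finsupp.induction_linear with
  | zero => simp
  | add f g hf hg =>
    simp only [map_add, Finsupp.add_apply, hf, hg]
    ring
  | single U c =>
    rw [bdry₂, Finsupp.linearCombination_single, Finsupp.smul_apply,
      boundaryChain_apply hF U.2, smul_eq_mul]
    simp only [hF.nonCrossing.edgeSegment_subset_frontier_iff hab U.2, Finsupp.single_apply]
    have hne := leftFace_ne hF hab
    obtain ⟨U, hU⟩ := U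
    simp only [Subtype.mk.injEq]
    by_cases h1 : U = F.leftFace a b
    · have h2 : U ≠ F.leftFace b a := fun h => hne (h1 ▸ h)
      simp [h1, hne]
    · simp [h1]

theorem bdry₁_bdry₂ (hF : F.IsPointedPseudoTriangulation) (f : F.faces →₀ ZMod 2) :
    F.bdry₁ (F.bdry₂ f) = 0 := by
  induction f using Finsupp.induction_linear with
  | zero => simp
  | add f g hf hg => simp [hf, hg]
  | single U c =>
    rw [bdry₂, Finsupp.linearCombination_single, map_smul, bdry₁_boundaryChain hF U.2, smul_zero]

theorem finite_faces_at_edge (hF : F.NonCrossing) {e : Sym2 V} (he : e ∈ F.graph.edgeSet) :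
    {U ∈ F.faces | F.edgeSegment e ⊆ frontier U}.Finite := by
  induction e using Sym2.ind with | _ a b =>
  refine Set.Finite.subset (s := {F.leftFace a b, F.leftFace b a}) (by simp) ?_
  rintro U ⟨hU, h⟩
  simpa using (hF.edgeSegment_subset_frontier_iff he hU).1 h

theorem exists_edge_of_face (hF : F.IsPointedPseudoTriangulation) {U : Set Plane}
    (hU : U ∈ F.faces) : ∃ e ∈ F.graph.edgeSet, F.edgeSegment e ⊆ frontier U := by
  obtain ⟨v, w, hw, -⟩ := hF.pseudoTriangle U hU
  obtain ⟨e, he, -⟩ := (SimpleGraph.Walk.mem_support_iff_exists_mem_edges_of_not_nil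
    hw.1.not_nil).1 w.start_mem_support
  have he' := w.edges_subset_edgeSet he
  exact ⟨e, he', (hF.nonCrossing.mem_edges_iff hw he').1 he⟩

theorem finite_faces_of_frontier_subset (hF : F.IsPointedPseudoTriangulation) {B : Set Plane}
    (hB : Bornology.IsBounded B) : {U ∈ F.faces | frontier U ⊆ B}.Finite := by
  refine ((F.finite_edges_meeting hB).biUnion fun e he =>
    finite_faces_at_edge hF.nonCrossing he.1).subset ?_
  rintro U ⟨hU, hUB⟩
  obtain ⟨e, he, hsub⟩ := exists_edge_of_face hF hU
  refine Set.mem_biUnion (x := e) ⟨he, ?_⟩ ⟨hU, hsub⟩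
  obtain ⟨x, hx⟩ : (F.edgeSegment e).Nonempty := by
    induction e using Sym2.ind with | _ a b => exact ⟨_, left_mem_segment ..⟩
  exact ⟨x, hx, hUB (hsub hx)⟩

/-- The filling of `z` consists of the faces of odd parity. They lie in a bounded region, hence are
finitely many, and the coefficient of the boundary at an edge is the jump of the parity, which is
that of `z`. -/
theorem exists_bdry₂_eq (hF : F.IsPointedPseudoTriangulation) {z : F.graph.edgeSet →₀ ZMod 2}
    (hz : F.bdry₁ z = 0) : ∃ f, F.bdry₂ f = z := by
  have hnc := hF.nonCrossing
  obtain ⟨R, hR⟩ := exists_parity_eq_zero hz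
  have hpt : ∀ U : F.faces, ∃ x, x ∈ (U : Set Plane) := fun U =>
    (isConnected_of_mem_faces U.2).nonempty
  choose pt hpt using hpt
  have hfin : (Function.support fun U : F.faces => parity z (pt U)).Finite := by
    refine Set.Finite.of_finite_image (f := Subtype.val)
      ((finite_faces_of_frontier_subset hF (B := Metric.closedBall 0 R)
        Metric.isBounded_closedBall).subset ?_) Subtype.val_injective.injOn
    rintro _ ⟨U, hU, rfl⟩
    refine ⟨U.2, frontier_subset_closure.trans (Metric.isClosed_closedBall.closure_subset_iff.2 ?_)⟩
    intro x hx
    rw [mem_closedBall_zero_iff]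
    by_contra h
    exact hU ((parity_eq_of_mem_face hz U.2 (hpt U) hx).trans (hR x (not_le.1 h)))
  refine ⟨Finsupp.ofSupportFinite _ hfin, ?_⟩
  ext ⟨e, he⟩
  induction e using Sym2.ind with | _ a b =>
  rw [bdry₂_apply hF _ he]
  simp only [Finsupp.ofSupportFinite_coe]
  obtain ⟨q, hq⟩ : (openSegment ℝ (F.p a) (F.p b)).Nonempty :=
    ⟨_, mem_openSegment_iff_div.2 ⟨1, 1, one_pos, one_pos, rfl⟩⟩
  have hcT := crossTerm_eq_zero_of_mem_segment (openSegment_subset_segment _ _ _ hq)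
  obtain ⟨c, hc⟩ := hnc.parity_jump hz he hq
  have hev := hc.and (hnc.eventually_mem_leftFace he hq)
  obtain ⟨x, hx, hx1, hx2⟩ := ((frequently_crossTerm_pos (F.placement _ _ he) hcT).and_eventually
    hev).exists
  obtain ⟨y, hy, hy1, hy2⟩ := ((frequently_crossTerm_neg (F.placement _ _ he) hcT).and_eventually
    hev).exists
  have e1 := parity_eq_of_mem_face hz (hnc.leftFace_mem he)
    (hpt ⟨_, hnc.leftFace_mem he⟩) (hx2.1 hx)
  have e2 := parity_eq_of_mem_face hz (hnc.leftFace_mem (SimpleGraph.Adj.symm he))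
    (hpt ⟨_, hnc.leftFace_mem (SimpleGraph.Adj.symm he)⟩) (hy2.2 hy)
  rw [e1, e2, hx1.1 hx, hy1.2 hy, ← add_assoc, CharTwo.add_self_eq_zero, zero_add]

theorem exact_bdry (hF : F.IsPointedPseudoTriangulation) :
    Function.Exact F.bdry₂ F.bdry₁ := by
  intro z
  constructor
  · exact fun hz => exists_bdry₂_eq hF hz
  · rintro ⟨f, rfl⟩
    exact bdry₁_bdry₂ hF f

theorem single_sub_single_mem_range (x x' : V) :
    Finsupp.single x 1 - Finsupp.single x' 1 ∈ LinearMap.range F.bdry₁ := by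
  obtain ⟨w⟩ := F.connected.preconnected x x'
  induction w with
  | nil => simp
  | @cons u v w h p ih =>
    have h1 : (Finsupp.single u 1 - Finsupp.single v 1 : V →₀ ZMod 2) ∈
        LinearMap.range F.bdry₁ := by
      refine ⟨Finsupp.single ⟨s(u, v), h⟩ 1, ?_⟩
      simp [bdry₁, sub_eq_add_neg, ← Finsupp.single_neg]
    have := Submodule.add_mem _ h1 ih
    rwa [sub_add_sub_cancel] at this

/-! ### The action of the periodicity group -/

variable (F) in
/-- The translation of the plane by a period. -/
def shift (γ : F.Γ) : Plane ≃ₜ Plane := Homeomorph.addRight (F.π (Additive.ofMul γ))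

theorem shift_apply (γ : F.Γ) (x : Plane) : F.shift γ x = x + F.π (Additive.ofMul γ) := rfl

theorem shift_p (γ : F.Γ) (v : V) : F.shift γ (F.p v) = F.p (γ • v) := (F.periodic γ v).symm

theorem shift_image_mem_faces (γ : F.Γ) {U : Set Plane} (hU : U ∈ F.faces) :
    F.shift γ '' U ∈ F.faces := by
  obtain ⟨x, hx, rfl⟩ := hU
  have h : F.shift γ '' F.skeletonᶜ = F.skeletonᶜ := by
    rw [← Homeomorph.preimage_symm]
    ext y
    obtain ⟨y, rfl⟩ := (F.shift γ).surjective y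
    simp only [Set.mem_preimage, Homeomorph.symm_apply_apply, Set.mem_compl_iff]
    exact not_congr (F.mem_skeleton_translate γ y).symm
  refine ⟨F.shift γ x, ?_, ?_⟩
  · rw [← h]; exact ⟨x, hx, rfl⟩
  · rw [Homeomorph.image_connectedComponentIn _ hx, h]

instance : MulAction F.Γ F.graph.edgeSet where
  smul γ e := ⟨Sym2.map (γ : F.graph ≃g F.graph) e, (F.map_mem_edgeSet _).2 e.2⟩
  one_smul e := by
    apply Subtype.ext
    change Sym2.map id (e : Sym2 V) = e
    simp
  mul_smul γ δ e := by
    apply Subtype.ext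
    change Sym2.map (γ * δ : F.graph ≃g F.graph) (e : Sym2 V) = Sym2.map _ (Sym2.map _ _)
    rw [Sym2.map_map]
    rfl

theorem coe_smul_edge (γ : F.Γ) (e : F.graph.edgeSet) :
    ((γ • e : F.graph.edgeSet) : Sym2 V) = Sym2.map (γ : F.graph ≃g F.graph) e := rfl

instance : MulAction F.Γ F.faces where
  smul γ U := ⟨F.shift γ '' U, shift_image_mem_faces γ U.2⟩
  one_smul U := by
    apply Subtype.ext
    change (fun x => x + F.π (Additive.ofMul 1)) '' (U : Set Plane) = U
    simp
  mul_smul γ δ U := by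
    apply Subtype.ext
    change (fun x => x + F.π (Additive.ofMul (γ * δ))) '' (U : Set Plane) =
      (fun x => x + F.π (Additive.ofMul γ)) '' ((fun x => x + F.π (Additive.ofMul δ)) '' U)
    rw [Set.image_image]
    refine Set.image_congr fun x _ => ?_
    rw [ofMul_mul, map_add]
    abel

theorem coe_smul_face (γ : F.Γ) (U : F.faces) :
    ((γ • U : F.faces) : Set Plane) = F.shift γ '' U := rfl

theorem frontier_smul_face (γ : F.Γ) (U : F.faces) :
    frontier ((γ • U : F.faces) : Set Plane) = F.shift γ '' frontier (U : Set Plane) := by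
  rw [coe_smul_face, Homeomorph.image_frontier]

theorem edgeSegment_smul (γ : F.Γ) (e : F.graph.edgeSet) :
    F.edgeSegment (γ • e : F.graph.edgeSet) = F.shift γ '' F.edgeSegment e := by
  rw [← Homeomorph.preimage_symm]
  ext y
  obtain ⟨y, rfl⟩ := (F.shift γ).surjective y
  simp only [Set.mem_preimage, Homeomorph.symm_apply_apply]
  exact F.mem_edgeSegment_map γ.2 e y

theorem free_vertex (γ : F.Γ) (v : V) (h : γ • v = v) : γ = 1 := by
  by_contra hγ
  exact F.no_fixed_vertex γ γ.2 (fun h' => hγ (Subtype.ext h')) v h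

theorem free_edge (γ : F.Γ) (e : F.graph.edgeSet) (h : γ • e = e) : γ = 1 := by
  by_contra hγ
  exact F.no_fixed_edge γ γ.2 (fun h' => hγ (Subtype.ext h')) e e.2 (congrArg Subtype.val h)

theorem isBounded_frontier (hF : F.IsPointedPseudoTriangulation) {U : Set Plane}
    (hU : U ∈ F.faces) : Bornology.IsBounded (frontier U) := by
  obtain ⟨v, w, hw, -⟩ := hF.pseudoTriangle U hU
  rw [hw.2]
  exact (Bornology.isBounded_biUnion w.edges.finite_toSet).2
    fun e _ => (F.isCompact_edgeSegment e).isBounded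

/-- The frontier of a face fixed by `γ` is invariant under the translation by `π(γ)` but bounded and
nonempty, so the translation vector is zero. -/
theorem free_face (hF : F.IsPointedPseudoTriangulation) (γ : F.Γ) (U : F.faces)
    (h : γ • U = U) : γ = 1 := by
  obtain ⟨e, -, he⟩ := exists_edge_of_face hF U.2
  obtain ⟨x, hx⟩ : (F.edgeSegment e).Nonempty := by
    induction e using Sym2.ind with | _ a b => exact ⟨_, left_mem_segment ..⟩
  have hstep : ∀ y ∈ frontier (U : Set Plane), y + F.π (Additive.ofMul γ) ∈
      frontier (U : Set Plane) := by
    intro y hy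
    rw [← h, frontier_smul_face]
    exact ⟨y, hy, rfl⟩
  have hmem : ∀ k : ℕ, x + (k : ℝ) • F.π (Additive.ofMul γ) ∈ frontier (U : Set Plane) := by
    intro k
    induction k with
    | zero => simpa using he hx
    | succ k ih =>
      have := hstep _ ih
      rwa [add_assoc, ← one_smul ℝ (F.π (Additive.ofMul γ)), smul_smul, mul_one, ← add_smul,
        ← Nat.cast_succ] at this
  obtain ⟨R, hR⟩ := (isBounded_frontier hF U.2).exists_norm_le
  have h0 : F.π (Additive.ofMul γ) = 0 := by
    by_contra h0
    obtain ⟨k, hk⟩ := exists_nat_gt ((R + ‖x‖) / ‖F.π (Additive.ofMul γ)‖)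
    rw [div_lt_iff₀ (norm_pos_iff.2 h0)] at hk
    have h1 := hR _ (hmem k)
    have h2 := norm_sub_le (x + (k : ℝ) • F.π (Additive.ofMul γ)) x
    rw [add_sub_cancel_left, norm_smul, Real.norm_natCast] at h2
    linarith
  exact Additive.ofMul.injective (F.π_injective (h0.trans (map_zero F.π).symm))

/-! ### Orbit relations and finiteness of the orbit sets -/

theorem vertexSetoid_eq : F.vertexSetoid = MulAction.orbitRel F.Γ V := by
  ext u v
  rw [MulAction.orbitRel_apply, MulAction.mem_orbit_symm, MulAction.mem_orbit_iff]
  constructor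
  · rintro ⟨γ, hγ, h⟩
    exact ⟨⟨γ, hγ⟩, h⟩
  · rintro ⟨γ, h⟩
    exact ⟨γ, γ.2, h⟩

theorem edgeSetoid_eq : F.edgeSetoid = MulAction.orbitRel F.Γ F.graph.edgeSet := by
  ext u v
  rw [MulAction.orbitRel_apply, MulAction.mem_orbit_symm, MulAction.mem_orbit_iff]
  constructor
  · rintro ⟨γ, hγ, h⟩
    exact ⟨⟨γ, hγ⟩, Subtype.ext h⟩
  · rintro ⟨γ, h⟩
    exact ⟨γ, γ.2, congrArg Subtype.val h⟩

theorem faceSetoid_eq : F.faceSetoid = MulAction.orbitRel F.Γ F.faces := by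
  ext u v
  rw [MulAction.orbitRel_apply, MulAction.mem_orbit_symm, MulAction.mem_orbit_iff]
  constructor
  · rintro ⟨γ, h⟩
    exact ⟨γ, Subtype.ext h⟩
  · rintro ⟨γ, h⟩
    exact ⟨γ, congrArg Subtype.val h⟩

theorem finite_orbits_of_finite_set {A X : Type*} [Group A] [MulAction A X] {T : Set X}
    (hT : T.Finite) (h : ∀ x, ∃ t ∈ T, ∃ a : A, a • t = x) :
    Finite (MulAction.orbitRel.Quotient A X) := by
  have := hT.to_subtype
  refine Finite.of_surjective (fun t : T => Quotient.mk (MulAction.orbitRel A X) (t : X)) ?_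
  intro q
  induction q using Quotient.inductionOn with | _ x =>
  obtain ⟨t, ht, a, rfl⟩ := h x
  refine ⟨⟨t, ht⟩, Quotient.sound ?_⟩
  change MulAction.orbitRel A X _ _
  rw [MulAction.orbitRel_apply, MulAction.mem_orbit_symm]
  exact ⟨a, rfl⟩

instance : Finite (MulAction.orbitRel.Quotient F.Γ V) := by
  obtain ⟨T, hT, h⟩ := F.finite_vertices
  refine finite_orbits_of_finite_set hT fun v => ?_
  obtain ⟨u, hu, γ, hγ, h⟩ := h v
  exact ⟨u, hu, ⟨γ, hγ⟩, h⟩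

theorem exists_finite_edge_representatives : ∃ T : Set F.graph.edgeSet, T.Finite ∧
    ∀ e, ∃ t ∈ T, ∃ γ : F.Γ, γ • t = e := by
  obtain ⟨T, hT, h⟩ := F.finite_edges
  refine ⟨Subtype.val ⁻¹' T, hT.preimage Subtype.val_injective.injOn, fun e => ?_⟩
  obtain ⟨t, ht, γ, hγ, hte⟩ := h e e.2
  exact ⟨⟨t, (F.map_mem_edgeSet γ).1 (hte ▸ e.2)⟩, ht, ⟨γ, hγ⟩, Subtype.ext hte⟩

instance : Finite (MulAction.orbitRel.Quotient F.Γ F.graph.edgeSet) := by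
  obtain ⟨T, hT, h⟩ := exists_finite_edge_representatives (F := F)
  exact finite_orbits_of_finite_set hT h

/-- Every face can be translated so that one of its edges is a chosen representative, and an edge
borders at most two faces. -/
theorem finite_face_orbits (hF : F.IsPointedPseudoTriangulation) :
    Finite (MulAction.orbitRel.Quotient F.Γ F.faces) := by
  obtain ⟨T, hT, h⟩ := exists_finite_edge_representatives (F := F)
  refine finite_orbits_of_finite_set (T := ⋃ e ∈ T, {U : F.faces |
    F.edgeSegment e ⊆ frontier (U : Set Plane)}) (hT.biUnion fun e _ => ?_) fun U => ?_
  · refine Set.Finite.of_finite_image (f := Subtype.val)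
      ((finite_faces_at_edge hF.nonCrossing e.2).subset ?_) Subtype.val_injective.injOn
    rintro _ ⟨U, hU, rfl⟩
    exact ⟨U.2, hU⟩
  · obtain ⟨e, he, hU⟩ := exists_edge_of_face hF U.2
    obtain ⟨t, ht, γ, hγ⟩ := h ⟨e, he⟩
    refine ⟨γ⁻¹ • U, Set.mem_biUnion ht ?_, γ, smul_inv_smul _ _⟩
    change _ ⊆ frontier ((γ⁻¹ • U : F.faces) : Set Plane)
    obtain rfl : t = γ⁻¹ • ⟨e, he⟩ := by rw [← hγ, inv_smul_smul]
    rw [frontier_smul_face, edgeSegment_smul]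
    exact Set.image_mono hU

/-! ### Injectivity of the boundary of chains of faces -/

instance : Infinite F.Γ := by
  obtain ⟨e⟩ := F.free_abelian
  exact e.symm.toEquiv.infinite_iff.1 inferInstance

theorem countable_range_p : (Set.range F.p).Countable := by
  obtain ⟨e⟩ := F.free_abelian
  have : Countable F.Γ := e.toEquiv.countable_iff.2 (inferInstanceAs (Countable (ℤ × ℤ)))
  obtain ⟨T, hT, h⟩ := F.finite_vertices
  refine (hT.countable.biUnion fun u _ => Set.countable_range fun γ : F.Γ => F.p (γ • u)).mono ?_
  rintro _ ⟨v, rfl⟩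
  obtain ⟨u, hu, γ, hγ, rfl⟩ := h v
  exact Set.mem_biUnion hu ⟨⟨γ, hγ⟩, rfl⟩

/-- Removing only the vertices leaves paths that pass from face to face through the interiors of
edges. -/
theorem isConnected_compl_range_p : IsConnected (Set.range F.p)ᶜ := by
  refine countable_range_p.isConnected_compl_of_one_lt_rank ?_
  rw [← Module.finrank_eq_rank]
  simp

theorem exists_mem_openSegment_of_mem_skeleton {x : Plane} (hx : x ∈ F.skeleton)
    (hxp : x ∉ Set.range F.p) :
    ∃ a b, F.graph.Adj a b ∧ x ∈ openSegment ℝ (F.p a) (F.p b) := by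
  obtain ⟨e, he, hxe⟩ := F.mem_skeleton_iff.1 hx
  induction e using Sym2.ind with | _ a b =>
  exact ⟨a, b, he, mem_openSegment_of_ne_left_right (fun h => hxp ⟨a, h⟩)
    (fun h => hxp ⟨b, h⟩) hxe⟩

theorem frequently_notMem_skeleton (hF : F.NonCrossing) {x : Plane} (hxp : x ∉ Set.range F.p) :
    ∃ᶠ y in 𝓝 x, y ∉ F.skeleton := by
  by_cases hx : x ∈ F.skeleton
  · obtain ⟨a, b, hab, hq⟩ := exists_mem_openSegment_of_mem_skeleton hx hxp
    exact ((frequently_crossTerm_pos (F.placement _ _ hab) (crossTerm_eq_zero_of_mem_segment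
      (openSegment_subset_segment _ _ _ hq))).and_eventually
      (hF.eventually_mem_skeleton_iff hab hq)).mono fun y hy h => hy.1.ne' (hy.2.1 h)
  · exact Eventually.frequently (F.isClosed_skeleton.isOpen_compl.mem_nhds hx)

/-- A chain of faces with zero boundary has equal coefficients on the two sides of every edge. -/
theorem chain_locally_const (hF : F.IsPointedPseudoTriangulation) {f : F.faces →₀ ZMod 2}
    (hf : F.bdry₂ f = 0) {x : Plane} (hxp : x ∉ Set.range F.p) :
    ∃ c, ∀ᶠ y in 𝓝 x, ∀ U : F.faces, y ∈ (U : Set Plane) → f U = c := by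
  have hnc := hF.nonCrossing
  by_cases hx : x ∈ F.skeleton
  · obtain ⟨a, b, hab, hq⟩ := exists_mem_openSegment_of_mem_skeleton hx hxp
    have hLR := bdry₂_apply hF f hab
    rw [hf, Finsupp.zero_apply] at hLR
    refine ⟨f ⟨_, hnc.leftFace_mem hab⟩, ?_⟩
    filter_upwards [hnc.eventually_mem_leftFace hab hq,
      hnc.eventually_mem_skeleton_iff hab hq] with y h1 h2 U hyU
    have hy : crossTerm (F.p a) (F.p b) y ≠ 0 := fun h0 =>
      subset_compl_of_mem_faces U.2 hyU (h2.2 h0)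
    rcases hy.lt_or_gt with hy | hy
    · have : U = ⟨_, hnc.leftFace_mem hab.symm⟩ :=
        Subtype.ext (eq_of_mem_faces U.2 (hnc.leftFace_mem hab.symm) hyU (h1.2 hy))
      rw [this]
      exact (CharTwo.add_eq_zero.1 hLR.symm).symm
    · have : U = ⟨_, hnc.leftFace_mem hab⟩ :=
        Subtype.ext (eq_of_mem_faces U.2 (hnc.leftFace_mem hab) hyU (h1.1 hy))
      rw [this]
  · obtain ⟨U, hU, hxU⟩ := exists_mem_faces hx
    refine ⟨f ⟨U, hU⟩, ?_⟩
    filter_upwards [(isOpen_of_mem_faces hU).mem_nhds hxU] with y hy W hyW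
    have : W = ⟨U, hU⟩ := Subtype.ext (eq_of_mem_faces W.2 hU hyW hy)
    rw [this]

/-- The coefficients of a cycle of faces are locally constant off the vertices, hence all equal.
Since the free action produces infinitely many faces, finite support forces them to vanish. -/
theorem bdry₂_injective (hF : F.IsPointedPseudoTriangulation) : Function.Injective F.bdry₂ := by
  rw [injective_iff_map_eq_zero]
  intro f hf
  choose! c hc using fun x (hx : x ∈ (Set.range F.p)ᶜ) => chain_locally_const hF hf hx
  have hconst : ∀ x ∈ (Set.range F.p)ᶜ, ∀ y ∈ (Set.range F.p)ᶜ, c x = c y := by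
    intro x hx y hy
    refine (isConnected_compl_range_p (F := F)).isPreconnected.induction₂ (fun x y => c x = c y)
      ?_ (fun _ _ _ _ _ _ => Eq.trans) (fun _ _ _ _ => Eq.symm) hx hy
    intro x hx
    filter_upwards [eventually_nhdsWithin_of_eventually_nhds (hc x hx).eventually_nhds,
      self_mem_nhdsWithin] with y hy hys
    obtain ⟨z, hz1, hz2, hz3⟩ := ((frequently_notMem_skeleton hF.nonCrossing hys).and_eventually
      (hy.and (hc y hys))).exists
    obtain ⟨U, hU, hzU⟩ := exists_mem_faces hz1
    exact (hz2 ⟨U, hU⟩ hzU).symm.trans (hz3 ⟨U, hU⟩ hzU)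
  have hval : ∀ U W : F.faces, f U = f W := by
    have h1 : ∀ U : F.faces, ∃ x ∈ (Set.range F.p)ᶜ, f U = c x := by
      intro U
      obtain ⟨x, hx⟩ := (isConnected_of_mem_faces U.2).nonempty
      have hxp : x ∈ (Set.range F.p)ᶜ := by
        rintro ⟨v, rfl⟩
        exact subset_compl_of_mem_faces U.2 hx (F.p_mem_skeleton v)
      exact ⟨x, hxp, (hc x hxp).self_of_nhds U hx⟩
    intro U W
    obtain ⟨x, hx, hUx⟩ := h1 U
    obtain ⟨y, hy, hWy⟩ := h1 W
    rw [hUx, hWy, hconst x hx y hy]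
  ext U
  by_contra h
  have hinf : Infinite F.faces := Infinite.of_injective (fun γ : F.Γ => γ • U) (by
    intro γ δ h
    simp only at h
    have := free_face hF (δ⁻¹ * γ) U (by rw [mul_smul, h, inv_smul_smul])
    exact (inv_mul_eq_one.1 this).symm)
  exact Set.infinite_univ (f.support.finite_toSet.subset fun W _ => by
    rw [Finset.mem_coe, Finsupp.mem_support_iff, hval W U]; exact h)

/-! ### The Euler relation -/

variable (F) in
/-- The periodicity group is commutative. -/
abbrev periodCommGroup : CommGroup F.Γ :=
  { (inferInstance : Group F.Γ) with
    mul_comm := fun a b => by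
      obtain ⟨e⟩ := F.free_abelian
      exact e.injective (by rw [map_mul, map_mul, mul_comm]) }

/-- Euler's relation for the torus, read off from the chain complex of the plane over the group ring
of Γ. -/
theorem card_edgeOrbits_eq (hF : F.IsPointedPseudoTriangulation) :
    Nat.card (MulAction.orbitRel.Quotient F.Γ F.graph.edgeSet) =
      Nat.card (MulAction.orbitRel.Quotient F.Γ V) +
      Nat.card (MulAction.orbitRel.Quotient F.Γ F.faces) := by
  classical
  let _ := F.periodCommGroup
  have : UniqueProds F.Γ := by
    obtain ⟨e⟩ := F.free_abelian
    exact e.uniqueProds_iff.2 inferInstance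
  refine card_orbits_of_exact (k := ZMod 2) (A := F.Γ) free_vertex free_edge (free_face hF)
    F.bdry₁ F.bdry₂ ?_ ?_ (bdry₂_injective hF) (exact_bdry hF) single_sub_single_mem_range
  · intro γ z
    induction z using Finsupp.induction_linear with
    | zero => simp
    | add f g hf hg => simp only [map_add, hf, hg]
    | single e c =>
      obtain ⟨e, he⟩ := e
      rw [permRep_single]
      simp only [bdry₁, Finsupp.linearCombination_single, map_smul, coe_smul_edge]
      induction e using Sym2.ind with | _ a b =>
      rw [Sym2.map_mk, edgeSum_mk, edgeSum_mk, map_add, permRep_single, permRep_single]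
      rfl
  · intro γ z
    induction z using Finsupp.induction_linear with
    | zero => simp
    | add f g hf hg => simp only [map_add, hf, hg]
    | single U c =>
      rw [permRep_single]
      simp only [bdry₂, Finsupp.linearCombination_single, map_smul]
      congr 1
      ext e
      obtain ⟨e, rfl⟩ := MulAction.surjective γ e
      have : permRep (ZMod 2) F.Γ F.graph.edgeSet γ (F.boundaryChain U) (γ • e) =
          F.boundaryChain U e := by
        change Finsupp.mapDomain (γ • ·) _ (γ • e) = _
        exact Finsupp.mapDomain_apply (MulAction.injective γ) _ _
      rw [this, boundaryChain_apply hF (γ • U).2, boundaryChain_apply hF U.2, frontier_smul_face,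
        edgeSegment_smul, Set.image_subset_image_iff (F.shift γ).injective]

end PeriodicFramework

/-! ### Supporting half-planes of pointed sets -/

/-- A finite pointed set lies in a closed half-plane and not on its boundary line. -/
theorem IsPointedSet.exists_inner_nonneg {S : Set Plane} (hS : IsPointedSet S) (hfin : S.Finite) :
    ∃ n : Plane, (∀ x ∈ S, 0 ≤ inner ℝ n x) ∧ ∃ x ∈ S, 0 < inner ℝ n x := by
  classical
  have := hfin.fintype
  -- In the span, `T` is surjective and therefore open. The positive combinations then form an open
  -- convex set, which pointedness keeps away from 0, so that 0 can be strictly separated from it.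
  let W := Submodule.span ℝ S
  let g : S → W := fun x => ⟨x, Submodule.subset_span x.2⟩
  let T := Fintype.linearCombination ℝ g
  have hT : Function.Surjective T := by
    rw [← LinearMap.range_eq_top, Fintype.range_linearCombination]
    rw [eq_top_iff]
    rintro ⟨x, hx⟩ -
    have h1 : Set.range g = Subtype.val ⁻¹' S := by
      ext ⟨y, hy⟩
      constructor
      · rintro ⟨s, hs⟩
        have hs' : (s : Plane) = y := congrArg Subtype.val hs
        change y ∈ S
        exact hs' ▸ s.2
      · intro h
        exact ⟨⟨y, h⟩, rfl⟩
    rw [h1]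
    exact Submodule.span_span_coe_preimage (R := ℝ) (s := S) ▸ Submodule.mem_top
  have hopen : IsOpen (T '' Set.univ.pi fun _ => Set.Ioi 0) :=
    LinearMap.isOpenMap_of_finiteDimensional T hT _
      (isOpen_set_pi Set.finite_univ fun _ _ => isOpen_Ioi)
  have hconv : Convex ℝ (T '' Set.univ.pi fun _ => Set.Ioi 0) :=
    (convex_pi fun _ _ => convex_Ioi 0).linear_image T
  have h0 : (0 : W) ∉ T '' Set.univ.pi fun _ => Set.Ioi 0 := by
    rintro ⟨c, hc, hc0⟩
    refine hS ⟨fun x => if h : x ∈ S then c ⟨x, h⟩ else 0, fun x hx => ?_, ?_⟩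
    · simp only [dif_pos hx]
      exact hc _ trivial
    · rw [← finsum_set_coe_eq_finsum_mem, finsum_eq_sum_of_fintype]
      have := congrArg Subtype.val hc0
      simp only [T, Fintype.linearCombination_apply, g] at this
      simpa using this
  obtain ⟨f, hf⟩ := geometric_hahn_banach_point_open hconv hopen h0
  rw [map_zero] at hf
  let n : W := (InnerProductSpace.toDual ℝ W).symm f
  have hn : ∀ x : S, inner ℝ (n : Plane) (x : Plane) = f (g x) := by
    intro x
    change inner ℝ n (g x) = _
    rw [InnerProductSpace.toDual_symm_apply]
  have hpos : ∀ c : S → ℝ, (∀ x, 0 < c x) → 0 < ∑ x, c x * f (g x) := by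
    intro c hc
    have := hf (T c) ⟨c, fun x _ => hc x, rfl⟩
    simpa [T, Fintype.linearCombination_apply] using this
  refine ⟨n, fun x hx => ?_, ?_⟩
  · rw [hn ⟨x, hx⟩]
    by_contra hneg
    push Not at hneg
    set s : S := ⟨x, hx⟩
    let A := ∑ y, f (g y)
    -- The extra weight on `s` brings the total `A` down to `A - |A| ≤ 0`, although positive
    -- combinations have positive value.
    have := hpos (fun y => 1 + if y = s then |A| / (-f (g s)) else 0) (fun y => by
      have : 0 ≤ |A| / (-f (g s)) := div_nonneg (abs_nonneg _) (by linarith)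
      split_ifs <;> linarith)
    simp only [add_mul, one_mul, Finset.sum_add_distrib, ite_mul, zero_mul, Finset.sum_ite_eq',
      Finset.mem_univ, if_true] at this
    have e : |A| / (-f (g s)) * f (g s) = -|A| := by
      rw [div_neg, neg_mul, div_mul_cancel₀ _ hneg.ne]
    rw [e] at this
    have := le_abs_self A
    linarith
  · by_contra h
    push Not at h
    have := hpos 1 fun _ => one_pos
    have h' : ∑ x, (1 : S → ℝ) x * f (g x) ≤ 0 := Finset.sum_nonpos fun x _ => by
      rw [Pi.one_apply, one_mul, ← hn]
      exact h x x.2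
    linarith

/-! ### The measure of half-planes of directions -/

/-- The unit vector in a direction. -/
def unitVec (θ : ℝ) : Plane := !₂[Real.cos θ, Real.sin θ]

theorem continuous_unitVec : Continuous unitVec := by
  unfold unitVec
  fun_prop

theorem norm_unitVec (θ : ℝ) : ‖unitVec θ‖ = 1 := by
  rw [EuclideanSpace.norm_eq, Fin.sum_univ_two]
  simp [unitVec]

theorem inner_unitVec (n : Plane) (θ : ℝ) :
    inner ℝ n (unitVec θ) = n 0 * Real.cos θ + n 1 * Real.sin θ := by
  simp [unitVec, PiLp.inner_apply, Fin.sum_univ_two, mul_comm]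

theorem exists_eq_smul_unitVec (x : Plane) :
    ∃ θ ∈ Set.Ioc (-Real.pi) Real.pi, x = ‖x‖ • unitVec θ := by
  let z : ℂ := ⟨x 0, x 1⟩
  have hz : ‖z‖ = ‖x‖ := by
    rw [Complex.norm_def, Complex.normSq_mk, EuclideanSpace.norm_eq, Fin.sum_univ_two]
    simp [sq]
  refine ⟨z.arg, Complex.arg_mem_Ioc z, ?_⟩
  ext i
  fin_cases i
  · have := Complex.norm_mul_cos_arg z
    rw [hz] at this
    simpa [unitVec] using this.symm
  · have := Complex.norm_mul_sin_arg z
    rw [hz] at this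
    simpa [unitVec] using this.symm

/-- A nonempty set of directions that is relatively open has positive measure. -/
theorem volume_directions_pos {O : Set ℝ} (hO : IsOpen O) {θ : ℝ}
    (hθ : θ ∈ Set.Ioc (-Real.pi) Real.pi) (hθO : θ ∈ O) :
    0 < volume (Set.Ioc (-Real.pi) Real.pi ∩ O) := by
  have hlt : -Real.pi < Real.pi := by linarith [Real.pi_pos]
  have hcl : θ ∈ closure (Set.Ioo (-Real.pi) Real.pi) := by
    rw [closure_Ioo hlt.ne]
    exact Set.Ioc_subset_Icc_self hθ
  obtain ⟨y, hyO, hy⟩ := mem_closure_iff.1 hcl O hO hθO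
  exact ((isOpen_Ioo.inter hO).measure_pos volume ⟨y, hy, hyO⟩).trans_le
    (measure_mono (Set.inter_subset_inter_left _ Set.Ioo_subset_Ioc_self))

/-- Turning by π carries the negative directions in (-π, 0] to the positive ones in (0, π]. Together
with the negative directions in (0, π] these fill that interval up to at most one point, which gives
measure at least π. -/
theorem volume_halfPlane_directions {n : Plane} (hn : n ≠ 0) :
    ENNReal.ofReal Real.pi ≤
      volume (Set.Ioc (-Real.pi) Real.pi ∩ {θ | inner ℝ n (unitVec θ) < 0}) := by
  have hcont : Continuous fun θ => inner ℝ n (unitVec θ) := by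
    have := continuous_unitVec
    fun_prop
  have hneg : MeasurableSet {θ | inner ℝ n (unitVec θ) < 0} :=
    (isOpen_lt hcont continuous_const).measurableSet
  have hpos : MeasurableSet {θ | 0 < inner ℝ n (unitVec θ)} :=
    (isOpen_lt continuous_const hcont).measurableSet
  have hpi := Real.pi_pos
  have hzero : volume (Set.Ioc 0 Real.pi ∩ {θ | inner ℝ n (unitVec θ) = 0}) = 0 := by
    refine Set.Subsingleton.measure_zero ?_ _
    rintro α ⟨hα, hα0⟩ β ⟨hβ, hβ0⟩
    simp only [Set.mem_ofPred_eq, inner_unitVec] at hα0 hβ0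
    have hs : Real.sin (α - β) = 0 := by
      rw [Real.sin_sub]
      have h0 : n 0 * (Real.sin α * Real.cos β - Real.cos α * Real.sin β) = 0 := by
        linear_combination Real.sin α * hβ0 - Real.sin β * hα0
      have h1 : n 1 * (Real.sin α * Real.cos β - Real.cos α * Real.sin β) = 0 := by
        linear_combination Real.cos β * hα0 - Real.cos α * hβ0
      by_contra hne
      apply hn
      ext i
      fin_cases i
      · exact (mul_eq_zero.1 h0).resolve_right hne
      · exact (mul_eq_zero.1 h1).resolve_right hne
    have := (Real.sin_eq_zero_iff_of_lt_of_lt (by linarith [hα.1, hβ.2])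
      (by linarith [hα.2, hβ.1])).1 hs
    linarith
  have hshift : volume (Set.Ioc (-Real.pi) 0 ∩ {θ | inner ℝ n (unitVec θ) < 0}) =
      volume (Set.Ioc 0 Real.pi ∩ {θ | 0 < inner ℝ n (unitVec θ)}) := by
    rw [← measure_preimage_add_right volume Real.pi
      (Set.Ioc 0 Real.pi ∩ {θ | 0 < inner ℝ n (unitVec θ)})]
    congr 1
    ext θ
    simp only [Set.mem_inter_iff, Set.mem_Ioc, Set.mem_ofPred_eq, Set.mem_preimage, inner_unitVec,
      Real.cos_add_pi, Real.sin_add_pi]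
    constructor
    · rintro ⟨⟨h1, h2⟩, h3⟩
      exact ⟨⟨by linarith, by linarith⟩, by linarith⟩
    · rintro ⟨⟨h1, h2⟩, h3⟩
      exact ⟨⟨by linarith, by linarith⟩, by linarith⟩
  have hsplit : Set.Ioc (-Real.pi) Real.pi ∩ {θ | inner ℝ n (unitVec θ) < 0} =
      (Set.Ioc (-Real.pi) 0 ∩ {θ | inner ℝ n (unitVec θ) < 0}) ∪
      (Set.Ioc 0 Real.pi ∩ {θ | inner ℝ n (unitVec θ) < 0}) := by
    rw [← Set.union_inter_distrib_right, Set.Ioc_union_Ioc_eq_Ioc (by linarith) hpi.le]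
  have hdisj : Disjoint (Set.Ioc (-Real.pi) 0 ∩ {θ | inner ℝ n (unitVec θ) < 0})
      (Set.Ioc 0 Real.pi ∩ {θ | inner ℝ n (unitVec θ) < 0}) :=
    Set.disjoint_left.2 fun x hx hx' => not_lt.2 hx.1.2 hx'.1.1
  rw [hsplit, measure_union hdisj (measurableSet_Ioc.inter hneg), hshift]
  have hcover : Set.Ioc 0 Real.pi ⊆ (Set.Ioc 0 Real.pi ∩ {θ | 0 < inner ℝ n (unitVec θ)}) ∪
      (Set.Ioc 0 Real.pi ∩ {θ | inner ℝ n (unitVec θ) < 0}) ∪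
      (Set.Ioc 0 Real.pi ∩ {θ | inner ℝ n (unitVec θ) = 0}) := by
    intro θ hθ
    rcases lt_trichotomy (inner ℝ n (unitVec θ)) 0 with h | h | h
    · exact .inl (.inr ⟨hθ, h⟩)
    · exact .inr ⟨hθ, h⟩
    · exact .inl (.inl ⟨hθ, h⟩)
  calc ENNReal.ofReal Real.pi = volume (Set.Ioc 0 Real.pi) := by rw [Real.volume_Ioc, sub_zero]
    _ ≤ _ := (measure_mono hcover).trans (measure_union_le _ _)
    _ ≤ _ := by
      rw [hzero, add_zero]
      exact measure_union_le _ _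

namespace PeriodicFramework

variable {V : Type*} {F : PeriodicFramework V}

/-! ### Faces and edges at a vertex -/

variable (F) in
/-- The edges at a vertex. -/
def edgesAt (v : V) : Set F.graph.edgeSet := {e | v ∈ (e : Sym2 V)}

variable (F) in
/-- The faces at a vertex. -/
def facesAt (v : V) : Set F.faces := {U | F.p v ∈ frontier (U : Set Plane)}

theorem val_image_edgesAt (v : V) :
    Subtype.val '' F.edgesAt v = (fun u => s(v, u)) '' F.graph.neighborSet v := by
  ext e
  constructor
  · rintro ⟨⟨e, he⟩, hv, rfl⟩
    obtain ⟨u, rfl⟩ := Sym2.mem_iff_exists.1 hv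
    exact ⟨u, he, rfl⟩
  · rintro ⟨u, hu, rfl⟩
    exact ⟨⟨s(v, u), hu⟩, Sym2.mem_mk_left v u, rfl⟩

theorem finite_edgesAt (v : V) : (F.edgesAt v).Finite := by
  refine Set.Finite.of_finite_image (f := Subtype.val) ?_ Subtype.val_injective.injOn
  rw [val_image_edgesAt]
  exact (F.finite_degree v).image _

theorem exists_mem_edgesAt_of_mem_facesAt (hF : F.IsPointedPseudoTriangulation) {v : V}
    {U : F.faces} (hU : U ∈ F.facesAt v) :
    ∃ e ∈ F.edgesAt v, F.edgeSegment e ⊆ frontier (U : Set Plane) := by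
  obtain ⟨v', w, hw, -⟩ := hF.pseudoTriangle U U.2
  have := (hF.nonCrossing.mem_support_iff hw).2 hU
  rw [SimpleGraph.Walk.mem_support_iff_exists_mem_edges_of_not_nil hw.1.not_nil] at this
  obtain ⟨e, he, hve⟩ := this
  have he' := w.edges_subset_edgeSet he
  exact ⟨⟨e, he'⟩, hve, (hF.nonCrossing.mem_edges_iff hw he').1 he⟩

theorem finite_facesAt (hF : F.IsPointedPseudoTriangulation) (v : V) : (F.facesAt v).Finite := by
  refine Set.Finite.of_finite_image (f := Subtype.val) (((finite_edgesAt v).biUnion fun e _ =>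
    finite_faces_at_edge hF.nonCrossing e.2).subset ?_) Subtype.val_injective.injOn
  rintro _ ⟨U, hU, rfl⟩
  obtain ⟨e, he, h⟩ := exists_mem_edgesAt_of_mem_facesAt hF hU
  exact Set.mem_biUnion he ⟨U.2, h⟩

/-- A cycle has two edges at each of its vertices. -/
theorem ncard_boundary_edgesAt (hF : F.IsPointedPseudoTriangulation) {v : V}
    {U : F.faces} (hU : U ∈ F.facesAt v) :
    {e ∈ F.edgesAt v | F.edgeSegment e ⊆ frontier (U : Set Plane)}.ncard = 2 := by
  obtain ⟨v', w, hw, -⟩ := hF.pseudoTriangle U U.2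
  have hv := (hF.nonCrossing.mem_support_iff hw).2 hU
  refine Eq.trans ?_ (hw.1.ncard_neighborSet_toSubgraph_eq_two hv)
  rw [← Set.ncard_image_of_injective _ (Subtype.val_injective (p := (· ∈ F.graph.edgeSet))),
    ← Set.ncard_image_of_injective (w.toSubgraph.neighborSet v)
      (f := fun u => s(v, u)) (fun a b h => Sym2.congr_right.1 h)]
  congr 1
  ext e
  constructor
  · rintro ⟨⟨e, he⟩, ⟨hve, h⟩, rfl⟩
    obtain ⟨u, rfl⟩ := Sym2.mem_iff_exists.1 hve
    exact ⟨u, SimpleGraph.Walk.adj_toSubgraph_iff_mem_edges.2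
      ((hF.nonCrossing.mem_edges_iff hw he).2 h), rfl⟩
  · rintro ⟨u, hu, rfl⟩
    have hu := SimpleGraph.Walk.adj_toSubgraph_iff_mem_edges.1 hu
    have hu' := w.edges_subset_edgeSet hu
    exact ⟨⟨s(v, u), hu'⟩, ⟨Sym2.mem_mk_left v u, (hF.nonCrossing.mem_edges_iff hw hu').1 hu⟩, rfl⟩

theorem ncard_faces_at_edge (hF : F.IsPointedPseudoTriangulation) {v : V}
    {e : F.graph.edgeSet} (he : e ∈ F.edgesAt v) :
    {U ∈ F.facesAt v | F.edgeSegment e ⊆ frontier (U : Set Plane)}.ncard = 2 := by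
  obtain ⟨e, hadj⟩ := e
  obtain ⟨u, rfl⟩ := Sym2.mem_iff_exists.1 he
  have hnc := hF.nonCrossing
  rw [Set.ncard_eq_two]
  refine ⟨⟨_, hnc.leftFace_mem hadj⟩, ⟨_, hnc.leftFace_mem (SimpleGraph.Adj.symm hadj)⟩,
    fun h => leftFace_ne hF hadj (congrArg Subtype.val h), ?_⟩
  ext ⟨U, hU⟩
  simp only [Set.mem_ofPred_eq, hnc.edgeSegment_subset_frontier_iff hadj hU,
    Set.mem_insert_iff, Set.mem_singleton_iff, Subtype.mk.injEq, and_iff_right_iff_imp]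
  intro h
  exact (hnc.edgeSegment_subset_frontier_iff hadj hU).2 h (left_mem_segment ..)

/-- Double counting of incidences at `v`: each edge borders two faces and each face has two boundary
edges there. -/
theorem ncard_facesAt (hF : F.IsPointedPseudoTriangulation) (v : V) :
    (F.facesAt v).ncard = (F.edgesAt v).ncard := by
  classical
  have h := Finset.card_mul_eq_card_mul (m := 2) (n := 2)
    (fun (e : F.graph.edgeSet) (U : F.faces) => F.edgeSegment e ⊆ frontier (U : Set Plane))
    (s := (finite_edgesAt v).toFinset) (t := (finite_facesAt hF v).toFinset)
    (fun e he => by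
      refine Eq.trans ?_ (ncard_faces_at_edge hF ((finite_edgesAt v).mem_toFinset.1 he))
      rw [← Set.ncard_coe_finset]
      congr 1
      ext U
      simp [Finset.bipartiteAbove])
    (fun U hU => by
      refine Eq.trans ?_ (ncard_boundary_edgesAt hF ((finite_facesAt hF v).mem_toFinset.1 hU))
      rw [← Set.ncard_coe_finset]
      congr 1
      ext U
      simp [Finset.bipartiteBelow])
  rw [Set.ncard_eq_toFinset_card _ (finite_edgesAt v),
    Set.ncard_eq_toFinset_card _ (finite_facesAt hF v)]
  omega

/-! ### The neighbourhood of a vertex -/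

/-- A small disc meets only edges at `v`, and they all reach its rim, so inside it the skeleton is a
union of radii. Membership therefore depends on the direction alone. -/
theorem NonCrossing.exists_star (hF : F.NonCrossing) (v : V) : ∃ ε > 0,
    (∀ x ∈ Metric.ball (F.p v) ε, x ∈ F.skeleton →
      ∃ u, F.graph.Adj v u ∧ ∃ t : ℝ, 0 ≤ t ∧ x = F.p v + t • (F.p u - F.p v)) ∧
    ∀ d : Plane, ‖d‖ = 1 → ∀ r ∈ Set.Ioo 0 ε, ∀ r' ∈ Set.Ioo 0 ε,
      F.p v + r • d ∈ F.skeleton → F.p v + r' • d ∈ F.skeleton := by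
  have hcl := F.isClosed_union_edges (S := F.graph.edgeSet \ {e | v ∈ e}) Set.sdiff_subset
  have hnv : F.p v ∉ ⋃ e ∈ F.graph.edgeSet \ {e | v ∈ e}, F.edgeSegment e := by
    simp only [Set.mem_iUnion, not_exists]
    rintro e ⟨he, hne⟩ hqe
    exact hne (hF.mem_of_p_mem he hqe)
  obtain ⟨ε₁, hε₁, h₁⟩ := Metric.mem_nhds_iff.1 (hcl.isOpen_compl.mem_nhds hnv)
  have hlen : ∀ᶠ ε : ℝ in 𝓝[>] 0, ∀ u ∈ F.graph.neighborSet v, ε ≤ ‖F.p u - F.p v‖ := by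
    rw [(F.finite_degree v).eventually_all]
    intro u hu
    have : 0 < ‖F.p u - F.p v‖ := norm_pos_iff.2 (sub_ne_zero.2 (F.placement _ _ hu).symm)
    filter_upwards [Ioo_mem_nhdsGT this] with ε hε using hε.2.le
  obtain ⟨ε, hlen, hε0, hε1⟩ := (hlen.and (Ioo_mem_nhdsGT hε₁)).exists
  have hstar : ∀ x ∈ Metric.ball (F.p v) ε, x ∈ F.skeleton →
      ∃ u, F.graph.Adj v u ∧ ∃ t : ℝ, 0 ≤ t ∧ x = F.p v + t • (F.p u - F.p v) := by
    intro x hx hxs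
    obtain ⟨e, he, hxe⟩ := F.mem_skeleton_iff.1 hxs
    have hv : v ∈ e := by
      by_contra hv
      exact h₁ (Metric.ball_subset_ball hε1.le hx) (Set.mem_biUnion
        (show e ∈ F.graph.edgeSet \ {e | v ∈ e} from ⟨he, hv⟩) hxe)
    obtain ⟨u, rfl⟩ := Sym2.mem_iff_exists.1 hv
    rw [edgeSegment_mk, segment_eq_image'] at hxe
    obtain ⟨t, ht, rfl⟩ := hxe
    exact ⟨u, he, t, ht.1, rfl⟩
  refine ⟨ε, hε0, hstar, ?_⟩
  intro d hd r hr r' hr' h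
  obtain ⟨u, hu, t, ht, htx⟩ := hstar _ (by simp [norm_smul, hd, abs_of_pos hr.1, hr.2]) h
  have hrd : r • d = t • (F.p u - F.p v) := add_left_cancel htx
  have hr'd : r' • d = (r' / r * t) • (F.p u - F.p v) := by
    rw [mul_smul, ← hrd, smul_smul, div_mul_cancel₀ _ hr.1.ne']
  have hnorm : r' = r' / r * t * ‖F.p u - F.p v‖ := by
    have := congrArg norm hr'd
    rwa [norm_smul, norm_smul, hd, mul_one, Real.norm_eq_abs, Real.norm_eq_abs,
      abs_of_pos hr'.1, abs_of_nonneg (mul_nonneg (div_nonneg hr'.1.le hr.1.le) ht)] at this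
  refine F.edgeSegment_subset_skeleton (e := s(v, u)) hu ?_
  rw [edgeSegment_mk, segment_eq_image']
  refine ⟨r' / r * t, ⟨mul_nonneg (div_nonneg hr'.1.le hr.1.le) ht, ?_⟩, ?_⟩
  · by_contra hlt
    push Not at hlt
    have h1 := hlen u hu
    have h2 := hr'.2
    nlinarith
  · simp only [hr'd]

/-- The directions in which one enters a face from a vertex. -/
theorem NonCrossing.exists_angle_radius (hF : F.NonCrossing) (v : V) : ∃ ε > 0,
    (∀ x ∈ Metric.ball (F.p v) ε, x ∈ F.skeleton →
      ∃ u, F.graph.Adj v u ∧ ∃ t : ℝ, 0 ≤ t ∧ x = F.p v + t • (F.p u - F.p v)) ∧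
    ∀ d : Plane, ‖d‖ = 1 → ∀ U ∈ F.faces, ∀ r ∈ Set.Ioo 0 ε,
      ((∀ᶠ s : ℝ in 𝓝[>] 0, F.p v + s • d ∈ U) ↔ F.p v + r • d ∈ U) := by
  obtain ⟨ε, hε, hstar, hray⟩ := hF.exists_star v
  refine ⟨ε, hε, hstar, fun d hd U hU r hr => ?_⟩
  have key : ∀ r ∈ Set.Ioo 0 ε, ∀ r' ∈ Set.Ioo 0 ε, F.p v + r • d ∈ U → F.p v + r' • d ∈ U := by
    intro r hr r' hr' h
    have hpre : IsPreconnected ((fun s : ℝ => F.p v + s • d) '' Set.Ioo 0 ε) :=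
      isPreconnected_Ioo.image _ (by fun_prop)
    refine subset_of_mem_faces hU hpre ?_ ⟨r, hr, rfl⟩ h ⟨r', hr', rfl⟩
    rw [Set.disjoint_left]
    rintro _ ⟨s, hs, rfl⟩ hsk
    exact subset_compl_of_mem_faces hU h (hray d hd s hs r hr hsk)
  constructor
  · intro h
    obtain ⟨s, hs, hsε⟩ := (h.and (Ioo_mem_nhdsGT hε)).exists
    exact key s hsε r hr hs
  · intro h
    filter_upwards [Ioo_mem_nhdsGT hε] with s hs using key r hr s hs h

/-! ### The large angle at a vertex -/

/-- At a vertex of degree at most two, a supporting half-plane can be rotated. -/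
theorem exists_second_halfPlane {v u₀ : V} (hcard : (F.edgesAt v).ncard ≤ 2) {n : Plane}
    (hu₀ : F.graph.Adj v u₀) (hn : ∀ u, F.graph.Adj v u → 0 ≤ inner ℝ n (F.p u - F.p v))
    (hnu₀ : 0 < inner ℝ n (F.p u₀ - F.p v)) :
    ∃ m : Plane, (∀ u, F.graph.Adj v u → 0 ≤ inner ℝ m (F.p u - F.p v)) ∧
      0 < inner ℝ m (F.p u₀ - F.p v) ∧ ∃ x, inner ℝ m x < 0 ∧ 0 < inner ℝ n x := by
  have hcard' : (F.graph.neighborSet v).ncard ≤ 2 := by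
    rwa [← Set.ncard_image_of_injective _ Subtype.val_injective, val_image_edgesAt,
      Set.ncard_image_of_injective _ (fun a b h => Sym2.congr_right.1 h)] at hcard
  -- `J` is `n` turned by a right angle.
  let J : Plane := !₂[-n 1, n 0]
  have hJn : inner ℝ n J = 0 := by
    simp [J, PiLp.inner_apply, Fin.sum_univ_two]
    ring
  have hJJ : inner ℝ J J = inner ℝ n n := by
    rw [PiLp.inner_apply, PiLp.inner_apply, Fin.sum_univ_two, Fin.sum_univ_two]
    simp [J, add_comm]
  have hnn : 0 < inner ℝ n n := by
    rw [real_inner_self_pos]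
    rintro rfl
    simp at hnu₀
  -- At most one edge other than `u₀` is present, so one of the two senses of rotation keeps it on
  -- the nonnegative side.
  obtain ⟨σ, hσ0, hσ⟩ : ∃ σ : ℝ, σ ≠ 0 ∧ ∀ u, F.graph.Adj v u → u ≠ u₀ →
      0 ≤ σ * inner ℝ J (F.p u - F.p v) := by
    by_cases h : ∃ u₁, F.graph.Adj v u₁ ∧ u₁ ≠ u₀
    · obtain ⟨u₁, hu₁, hne⟩ := h
      have huniq : ∀ u, F.graph.Adj v u → u ≠ u₀ → u = u₁ := by
        intro u hu hu'
        by_contra hu''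
        exact not_lt.2 hcard' ((Set.two_lt_ncard_iff (F.finite_degree v)).2
          ⟨u, u₁, u₀, hu, hu₁, hu₀, hu'', hu', hne⟩)
      rcases le_total 0 (inner ℝ J (F.p u₁ - F.p v)) with h | h
      · exact ⟨1, one_ne_zero, fun u hu hu' => by rw [huniq u hu hu', one_mul]; exact h⟩
      · exact ⟨-1, by norm_num, fun u hu hu' => by rw [huniq u hu hu']; linarith⟩
    · exact ⟨1, one_ne_zero, fun u hu hu' => absurd ⟨u, hu, hu'⟩ h⟩
  set i₀ := inner ℝ n (F.p u₀ - F.p v)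
  set j₀ := σ * inner ℝ J (F.p u₀ - F.p v)
  -- The rotation is small enough, `δ|j₀| < i₀`, to leave `u₀` strictly inside.
  have hδ : 0 < i₀ / (|j₀| + 1) := div_pos hnu₀ (by positivity)
  set δ := i₀ / (|j₀| + 1)
  have hm : ∀ x, inner ℝ (n + (δ * σ) • J) x = inner ℝ n x + δ * (σ * inner ℝ J x) := by
    intro x
    rw [inner_add_left, real_inner_smul_left, mul_assoc]
  have hm₀ : 0 < inner ℝ (n + (δ * σ) • J) (F.p u₀ - F.p v) := by
    rw [hm]
    change 0 < i₀ + δ * j₀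
    have h1 : δ * (|j₀| + 1) = i₀ := div_mul_cancel₀ _ (by positivity)
    have h2 := neg_abs_le j₀
    nlinarith
  -- The last witness has product |n|² with `n` and |n|² - 2|n|² = -|n|² with the rotated normal.
  refine ⟨n + (δ * σ) • J, fun u hu => ?_, hm₀, n - (2 / (δ * σ)) • J, ?_, ?_⟩
  · by_cases h : u = u₀
    · rw [h]; exact hm₀.le
    · rw [hm]
      exact add_nonneg (hn u hu) (mul_nonneg hδ.le (hσ u hu h))
  · rw [hm, inner_sub_right, inner_sub_right, inner_smul_right, inner_smul_right, hJn, hJJ,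
      real_inner_comm n J, hJn]
    have : δ * (σ * (0 - 2 / (δ * σ) * inner ℝ n n)) = -2 * inner ℝ n n := by
      have := hδ.ne'
      field_simp
      ring
    rw [this]
    linarith
  · rw [inner_sub_right, inner_smul_right, hJn]
    linarith

/-- At every vertex exactly one face has an angle of at least `π`. -/
theorem exists_large_angle (hF : F.IsPointedPseudoTriangulation) (v : V) :
    ∃ U₀ ∈ F.facesAt v, Real.pi ≤ interiorAngle U₀ (F.p v) ∧
      ∀ W ∈ F.facesAt v, W ≠ U₀ → interiorAngle W (F.p v) < Real.pi := by
  obtain ⟨ε, hε, hstar, hang⟩ := hF.nonCrossing.exists_angle_radius v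
  have hr : ε / 2 ∈ Set.Ioo 0 ε := ⟨by linarith, by linarith⟩
  -- Near `p v` faces are unions of open radii, so angles can be measured on the circle of radius `ε
  -- / 2`.
  let O : F.faces → Set ℝ := fun U => {θ | F.p v + (ε / 2) • unitVec θ ∈ (U : Set Plane)}
  let I := Set.Ioc (-Real.pi) Real.pi
  have hOo : ∀ U, IsOpen (O U) := fun U => (isOpen_of_mem_faces U.2).preimage (by
    have := continuous_unitVec
    fun_prop)
  have hint : ∀ U : F.faces, interiorAngle U (F.p v) = (volume (I ∩ O U)).toReal := by
    intro U
    unfold interiorAngle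
    congr 2
    ext θ
    exact and_congr_right fun _ => hang (unitVec θ) (norm_unitVec θ) U U.2 _ hr
  have hmeas : ∀ U, MeasurableSet (I ∩ O U) := fun U =>
    measurableSet_Ioc.inter (hOo U).measurableSet
  have hdisj : ∀ U W : F.faces, U ≠ W → Disjoint (I ∩ O U) (I ∩ O W) := fun U W hne =>
    Set.disjoint_left.2 fun θ h1 h2 => hne (Subtype.ext (eq_of_mem_faces U.2 W.2 h1.2 h2.2))
  have hpos : ∀ U ∈ F.facesAt v, 0 < volume (I ∩ O U) := by
    intro U hU
    have hcl : F.p v ∈ closure (U : Set Plane) := frontier_subset_closure hU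
    obtain ⟨x, hx, hxU⟩ := mem_closure_iff.1 hcl _ Metric.isOpen_ball (Metric.mem_ball_self hε)
    have hne : x - F.p v ≠ 0 := by
      intro h
      rw [sub_eq_zero] at h
      exact subset_compl_of_mem_faces U.2 hxU (h ▸ F.p_mem_skeleton v)
    obtain ⟨θ, hθ, hxθ⟩ := exists_eq_smul_unitVec (x - F.p v)
    refine volume_directions_pos (hOo U) hθ ?_
    have hnx : ‖x - F.p v‖ ∈ Set.Ioo 0 ε := ⟨norm_pos_iff.2 hne, mem_ball_iff_norm.1 hx⟩
    have h1 := hang (unitVec θ) (norm_unitVec θ) U U.2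
    refine (h1 _ hr).1 ((h1 _ hnx).2 ?_)
    rw [← hxθ, add_sub_cancel]
    exact hxU
  have htot : volume I = ENNReal.ofReal (2 * Real.pi) := by
    rw [Real.volume_Ioc]
    congr 1
    ring
  have hhalf : ∀ n : Plane, (∀ u, F.graph.Adj v u → 0 ≤ inner ℝ n (F.p u - F.p v)) →
      Disjoint (Metric.ball (F.p v) ε ∩ {x | inner ℝ n (x - F.p v) < 0}) F.skeleton ∧
      Convex ℝ (Metric.ball (F.p v) ε ∩ {x | inner ℝ n (x - F.p v) < 0}) := by
    intro n hn
    constructor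
    · rw [Set.disjoint_left]
      rintro x ⟨hx, hx'⟩ hxs
      obtain ⟨u, hu, t, ht, rfl⟩ := hstar x hx hxs
      simp only [Set.mem_ofPred_eq, add_sub_cancel_left, inner_smul_right] at hx'
      exact not_lt.2 (mul_nonneg ht (hn u hu)) hx'
    · refine (convex_ball _ _).inter ?_
      have : {x | inner ℝ n (x - F.p v) < 0} = {x | innerₗ Plane n x < inner ℝ n (F.p v)} := by
        ext x
        simp [inner_sub_right]
      rw [this]
      exact convex_halfSpace_lt (innerₗ Plane n).isLinear _
  have hray : ∀ (n : Plane) (U : F.faces),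
      Metric.ball (F.p v) ε ∩ {x | inner ℝ n (x - F.p v) < 0} ⊆ U →
      I ∩ {θ | inner ℝ n (unitVec θ) < 0} ⊆ I ∩ O U := by
    intro n U h θ hθ
    refine ⟨hθ.1, h ⟨?_, ?_⟩⟩
    · rw [mem_ball_iff_norm, add_sub_cancel_left, norm_smul, norm_unitVec, mul_one,
        Real.norm_eq_abs, abs_of_pos hr.1]
      exact hr.2
    · rw [Set.mem_ofPred_eq, add_sub_cancel_left, inner_smul_right]
      exact mul_neg_of_pos_of_neg hr.1 hθ.2
  obtain ⟨n, hn, hn'⟩ := (hF.pointed v).exists_inner_nonneg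
    (((F.finite_degree v).image fun u => F.p u - F.p v).subset (by
      rintro _ ⟨u, hu, rfl⟩
      exact ⟨u, hu, rfl⟩))
  obtain ⟨_, ⟨u₀, hu₀, rfl⟩, hnu₀⟩ := hn'
  replace hn : ∀ u, F.graph.Adj v u → 0 ≤ inner ℝ n (F.p u - F.p v) :=
    fun u hu => hn _ ⟨u, hu, rfl⟩
  have hn0 : n ≠ 0 := by
    rintro rfl
    simp at hnu₀
  obtain ⟨s, hs0, hsε⟩ : ∃ s : ℝ, 0 < s ∧ F.p v - s • (F.p u₀ - F.p v) ∈
      Metric.ball (F.p v) ε := by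
    have hc : Continuous fun s : ℝ => F.p v - s • (F.p u₀ - F.p v) := by fun_prop
    have := hc.continuousAt (x := 0) |>.eventually
      (Metric.isOpen_ball.mem_nhds (x := F.p v - (0 : ℝ) • (F.p u₀ - F.p v))
        (s := Metric.ball (F.p v) ε) (by simp [hε]))
    obtain ⟨s, h1, h2⟩ := ((this.filter_mono nhdsWithin_le_nhds).and
      (self_mem_nhdsWithin (s := Set.Ioi (0 : ℝ)))).exists
    exact ⟨s, h2, h1⟩
  have hback : ∀ m : Plane, 0 < inner ℝ m (F.p u₀ - F.p v) → F.p v - s • (F.p u₀ - F.p v) ∈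
      Metric.ball (F.p v) ε ∩ {x | inner ℝ m (x - F.p v) < 0} := by
    intro m hm
    refine ⟨hsε, ?_⟩
    rw [Set.mem_ofPred_eq, sub_sub_cancel_left, inner_neg_right, inner_smul_right]
    exact neg_neg_of_pos (mul_pos hs0 hm)
  -- The half-disc opposite to all edges avoids the skeleton and lies in one face, which has the
  -- large angle.
  obtain ⟨U₀, hU₀, hsub⟩ := exists_face_superset (F := F) (hhalf n hn).2.isPreconnected
    ⟨_, hback n hnu₀⟩ (hhalf n hn).1
  have hPle := (volume_halfPlane_directions hn0).trans (measure_mono (hray n ⟨U₀, hU₀⟩ hsub))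
  have hfinite : ∀ U, volume (I ∩ O U) ≠ ⊤ := fun U =>
    ((measure_mono Set.inter_subset_left).trans_lt (htot ▸ ENNReal.ofReal_lt_top)).ne
  refine ⟨⟨U₀, hU₀⟩, ?_, ?_, ?_⟩
  · change F.p v ∈ frontier U₀
    rw [(isOpen_of_mem_faces hU₀).frontier_eq]
    refine ⟨?_, fun h => subset_compl_of_mem_faces hU₀ h (F.p_mem_skeleton v)⟩
    have hc : Continuous fun s : ℝ => F.p v - s • (F.p u₀ - F.p v) := by fun_prop
    have hlim : Tendsto (fun s : ℝ => F.p v - s • (F.p u₀ - F.p v)) (𝓝[>] 0) (𝓝 (F.p v)) := by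
      have := hc.tendsto 0
      rw [zero_smul, sub_zero] at this
      exact this.mono_left nhdsWithin_le_nhds
    refine mem_closure_of_tendsto hlim ?_
    filter_upwards [hlim.eventually (Metric.ball_mem_nhds _ hε), self_mem_nhdsWithin]
      with s h1 (h2 : 0 < s)
    refine hsub ⟨h1, ?_⟩
    rw [Set.mem_ofPred_eq, sub_sub_cancel_left, inner_neg_right, inner_smul_right]
    exact neg_neg_of_pos (mul_pos h2 hnu₀)
  · rw [hint]
    exact (ENNReal.ofReal_le_iff_le_toReal (hfinite _)).1 hPle
  · intro W hW hne
    -- The half-plane takes at least π of the total 2π. Any set `D` of positive measure disjoint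
    -- from it and from `W` then makes the angle of `W` strictly smaller than π.
    have hfin : ∀ D : Set ℝ, MeasurableSet D → D ⊆ I →
        volume D ≠ 0 → Disjoint (I ∩ O W) D →
        Disjoint (I ∩ {θ | inner ℝ n (unitVec θ) < 0}) D → interiorAngle W (F.p v) < Real.pi := by
      intro D hD hDI hD0 hd1 hd2
      set P := I ∩ {θ | inner ℝ n (unitVec θ) < 0}
      have hPW : Disjoint P (I ∩ O W) :=
        (hdisj ⟨U₀, hU₀⟩ W hne.symm).mono_left (hray n ⟨U₀, hU₀⟩ hsub)
      have hsum : volume P + volume (I ∩ O W) + volume D ≤ ENNReal.ofReal (2 * Real.pi) := by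
        rw [← htot, ← measure_union hPW (hmeas W), ← measure_union
          (Set.disjoint_union_left.2 ⟨hd2, hd1⟩) hD]
        exact measure_mono (Set.union_subset (Set.union_subset Set.inter_subset_left
          Set.inter_subset_left) hDI)
      have hDt : volume D ≠ ⊤ :=
        ((measure_mono hDI).trans_lt (htot ▸ ENNReal.ofReal_lt_top)).ne
      have hPt : volume P ≠ ⊤ :=
        ((measure_mono Set.inter_subset_left).trans_lt (htot ▸ ENNReal.ofReal_lt_top)).ne
      have h1 := ENNReal.toReal_mono ENNReal.ofReal_ne_top hsum
      rw [ENNReal.toReal_add (ENNReal.add_ne_top.2 ⟨hPt, hfinite W⟩) hDt,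
        ENNReal.toReal_add hPt (hfinite W),
        ENNReal.toReal_ofReal (by linarith [Real.pi_pos])] at h1
      have h2 := (ENNReal.ofReal_le_iff_le_toReal hPt).1 (volume_halfPlane_directions hn0)
      have h3 := ENNReal.toReal_pos hD0 hDt
      rw [hint]
      linarith
    -- With a third face at `v`, its directions serve as `D`. Otherwise the degree is at most two
    -- and a slightly rotated half-plane also lies in `U₀`; what it adds to the first one serves as
    -- `D`.
    by_cases h3 : ∃ X ∈ F.facesAt v, X ≠ ⟨U₀, hU₀⟩ ∧ X ≠ W
    · obtain ⟨X, hX, hX0, hXW⟩ := h3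
      exact hfin (I ∩ O X) (hmeas X) Set.inter_subset_left (hpos X hX).ne'
        (hdisj W X hXW.symm)
        ((hdisj ⟨U₀, hU₀⟩ X hX0.symm).mono_left (hray n ⟨U₀, hU₀⟩ hsub))
    · have hcard : (F.edgesAt v).ncard ≤ 2 := by
        rw [← ncard_facesAt hF]
        refine (Set.ncard_le_ncard (t := {⟨U₀, hU₀⟩, W}) (fun X hX => ?_)).trans
          (Set.ncard_insert_le _ _ |>.trans (by simp))
        by_contra hX'
        simp only [Set.mem_insert_iff, Set.mem_singleton_iff, not_or] at hX'
        exact h3 ⟨X, hX, hX'⟩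
      obtain ⟨m, hm, hm₀, hmn⟩ := exists_second_halfPlane hcard hu₀ hn hnu₀
      obtain ⟨U₁, hU₁, hsub₁⟩ := exists_face_superset (F := F) (hhalf m hm).2.isPreconnected
        ⟨_, hback m hm₀⟩ (hhalf m hm).1
      -- Both half-discs contain points opposite to the edge towards `u₀`.
      obtain rfl : U₁ = U₀ :=
        eq_of_mem_faces hU₁ hU₀ (hsub₁ (hback m hm₀)) (hsub (hback n hnu₀))
      obtain ⟨x, hx1, hx2⟩ := hmn
      obtain ⟨θ, hθ, hxθ⟩ := exists_eq_smul_unitVec x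
      rw [hxθ, inner_smul_right] at hx1 hx2
      have hDo : IsOpen {θ | inner ℝ m (unitVec θ) < 0 ∧ 0 < inner ℝ n (unitVec θ)} := by
        have hc : ∀ m : Plane, Continuous fun θ => inner ℝ m (unitVec θ) :=
          fun m => continuous_const.inner continuous_unitVec
        exact (isOpen_lt (hc m) continuous_const).inter (isOpen_lt continuous_const (hc n))
      refine hfin (I ∩ {θ | inner ℝ m (unitVec θ) < 0 ∧ 0 < inner ℝ n (unitVec θ)})
        (measurableSet_Ioc.inter hDo.measurableSet) Set.inter_subset_left
        (volume_directions_pos hDo hθ ⟨?_, pos_of_mul_pos_right hx2 (norm_nonneg _)⟩).ne' ?_ ?_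
      · exact neg_of_mul_neg_right hx1 (norm_nonneg _)
      · exact (hdisj W ⟨U₁, hU₀⟩ hne).mono_right
          (fun θ hθ => hray m ⟨U₁, hU₀⟩ hsub₁ ⟨hθ.1, hθ.2.1⟩)
      · exact Set.disjoint_left.2 fun θ h1 h2 => lt_asymm h1.2 h2.2.2

/-! ### Counting angles and the main theorem -/

theorem interiorAngle_shift (γ : F.Γ) (U : Set Plane) (x : Plane) :
    interiorAngle (F.shift γ '' U) (F.shift γ x) = interiorAngle U x := by
  unfold interiorAngle
  congr 2
  ext θ
  refine and_congr_right fun _ => eventually_congr (.of_forall fun r => ?_)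
  rw [← (F.shift γ).injective.mem_set_image (s := U), shift_apply, shift_apply, add_right_comm]

variable (F) in
/-- The incidences of vertices and edges. -/
def vertexEdgeIncidences : SubMulAction F.Γ (V × F.graph.edgeSet) where
  carrier := {x | x.2 ∈ F.edgesAt x.1}
  smul_mem' _ x hx := Sym2.mem_map.2 ⟨x.1, hx, rfl⟩

variable (F) in
/-- The internal angles smaller than `π`. -/
def smallAngles : SubMulAction F.Γ (V × F.faces) where
  carrier := {x | x.2 ∈ F.facesAt x.1 ∧ interiorAngle x.2 (F.p x.1) < Real.pi}
  smul_mem' γ x hx := by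
    refine ⟨?_, ?_⟩
    · change F.p (γ • x.1) ∈ frontier ((γ • x.2 : F.faces) : Set Plane)
      rw [frontier_smul_face, ← shift_p]
      exact ⟨_, hx.1, rfl⟩
    · change interiorAngle ((γ • x.2 : F.faces) : Set Plane) (F.p (γ • x.1)) < _
      rw [coe_smul_face, ← shift_p, interiorAngle_shift]
      exact hx.2

/-- All angles at `v` but the large one are small, and there are as many angles as edges. -/
theorem ncard_smallAngles_vertex (hF : F.IsPointedPseudoTriangulation) (v : V) :
    {U | (v, U) ∈ F.smallAngles}.ncard + 1 = {e | (v, e) ∈ F.vertexEdgeIncidences}.ncard := by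
  obtain ⟨U₀, hU₀, hle, hlt⟩ := exists_large_angle hF v
  have h : {U | (v, U) ∈ F.smallAngles} = F.facesAt v \ {U₀} := by
    ext U
    constructor
    · rintro ⟨h1, h2⟩
      refine ⟨h1, ?_⟩
      rintro rfl
      exact not_lt.2 hle h2
    · rintro ⟨h1, h2⟩
      exact ⟨h1, hlt U h1 h2⟩
  rw [h, Set.ncard_sdiff_singleton_add_one hU₀ (finite_facesAt hF v)]
  exact ncard_facesAt hF v

theorem ncard_smallAngles_face (hF : F.IsPointedPseudoTriangulation) (U : F.faces) :
    {v | (v, U) ∈ F.smallAngles}.ncard = 3 := by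
  obtain ⟨v, w, hw, h⟩ := hF.pseudoTriangle U U.2
  rw [← h]
  congr 1
  ext u
  exact and_congr_left fun _ => (hF.nonCrossing.mem_support_iff hw).symm

theorem ncard_vertexEdgeIncidences_edge (e : F.graph.edgeSet) :
    {v | (v, e) ∈ F.vertexEdgeIncidences}.ncard = 2 := by
  obtain ⟨e, he⟩ := e
  induction e using Sym2.ind with | _ a b =>
  rw [Set.ncard_eq_two]
  refine ⟨a, b, SimpleGraph.Adj.ne he, ?_⟩
  ext v
  exact Sym2.mem_iff

end PeriodicFramework

end

theorem mainTheorem8 {V : Type*} (F : PeriodicFramework V)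
    (hF : F.IsPointedPseudoTriangulation) :
    Finite F.VertexOrbits ∧ Finite F.EdgeOrbits ∧ Finite F.FaceOrbits ∧
      Nat.card F.EdgeOrbits = 2 * Nat.card F.VertexOrbits ∧
      2 * Nat.card F.VertexOrbits = 2 * Nat.card F.FaceOrbits := by
  unfold PeriodicFramework.VertexOrbits PeriodicFramework.EdgeOrbits PeriodicFramework.FaceOrbits
  rw [PeriodicFramework.vertexSetoid_eq, PeriodicFramework.edgeSetoid_eq,
    PeriodicFramework.faceSetoid_eq]
  have hVfin : Finite (MulAction.orbitRel.Quotient F.Γ V) := inferInstance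
  have hEfin : Finite (MulAction.orbitRel.Quotient F.Γ F.graph.edgeSet) := inferInstance
  have hFfin := PeriodicFramework.finite_face_orbits hF
  have euler := PeriodicFramework.card_edgeOrbits_eq hF
  have h₂ := sum_ncard_fibre_eq PeriodicFramework.free_vertex PeriodicFramework.free_edge
    F.vertexEdgeIncidences PeriodicFramework.finite_edgesAt two_ne_zero
    PeriodicFramework.ncard_vertexEdgeIncidences_edge
  have h₃ := sum_ncard_fibre_eq PeriodicFramework.free_vertex (PeriodicFramework.free_face hF)
    F.smallAngles (fun v => (PeriodicFramework.finite_facesAt hF v).subset fun U hU => hU.1)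
    three_ne_zero (PeriodicFramework.ncard_smallAngles_face hF)
  have := Fintype.ofFinite (MulAction.orbitRel.Quotient F.Γ V)
  have hsum := finsum_congr fun q : MulAction.orbitRel.Quotient F.Γ V =>
    PeriodicFramework.ncard_smallAngles_vertex hF (Quotient.out q)
  -- Summed over vertex orbits, this becomes 3n* + n = 2m, to be combined with m = n + n* from
  -- `euler`.
  rw [h₂, finsum_eq_sum_of_fintype, Finset.sum_add_distrib, ← finsum_eq_sum_of_fintype, h₃,
    Finset.sum_const, smul_eq_mul, mul_one, Finset.card_univ, ← Nat.card_eq_fintype_card] at hsum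
  refine ⟨hVfin, hEfin, hFfin, ?_⟩
  change Nat.card (MulAction.orbitRel.Quotient F.Γ F.graph.edgeSet) =
    2 * Nat.card (MulAction.orbitRel.Quotient F.Γ V) ∧
    2 * Nat.card (MulAction.orbitRel.Quotient F.Γ V) =
    2 * Nat.card (MulAction.orbitRel.Quotient F.Γ F.faces)
  omega
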